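/- Let $\mathcal K$ be a field of characteristic zero, let $N,k\ge 1$ be integers, put $n=kN$, let $t\in\mathcal K^\times$ not be a root of unity, and put $q=t^{-2k}$. Let $\mathbb H_{q,t}(GL_n)$ be the double affine Hecke algebra, i.e. the $\mathcal K$-algebra generated by $T_0,\dots,T_{n-1}$, $\pi^{\pm1}$ and pairwise commuting $Y_1^{\pm1},\dots,Y_n^{\pm1}$, with relations (indices of the $T_i$ modulo $n$) $$(T_i-t)(T_i+t^{-1})=0,\qquad T_iT_{i+1}T_i=T_{i+1}T_iT_{i+1},\qquad T_iT_j=T_jT_i\ \ (j\not\equiv i\pm1),$$ $$\pi T_i\pi^{-1}=T_{i+1},\qquad T_iY_iT_i=Y_{i+1}\ (1\le i\le n-1),\qquad T_0Y_nT_0=q^{-1}Y_1,$$ $$T_iY_j=Y_jT_i\ \ (j\not\equiv i,i+1 \bmod n),\qquad \pi Y_i\pi^{-1}=Y_{i+1}\ (1\le i\le n-1),\qquad \pi Y_n\pi^{-1}=q^{-1}Y_1,$$ where the braid and commutation relations among the $T_i$ (second and third relation) are dropped if $n=2$. Let $H(\mathcal Y)\subseteq\mathbb H_{q,t}(GL_n)$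 be the subalgebra generated by $T_1,\dots,T_{n-1},Y_1^{\pm1},\dots,Y_n^{\pm1}$. Let $S$ be the $\mathcal K$-vector space with basis $v_R$, where $R$ runs over the standard Young tableaux of shape $(k^N)$ ($N$ rows of length $k$). For the box of $R$ containing $i$, let $\mathrm{diag}_R(i)$ be its column index minus its row index. Let the finite Hecke algebra, generated by $T_1,\dots,T_{n-1}$, act on $S$ by the irreducible representation attached to $(k^N)$ in Young's seminormal form $$T_i v_R=c\,v_R+(t^{-1}+c)\,v_{s_iR},\qquad c=\frac{t-t^{-1}}{1-t^{2(\mathrm{diag}_R(i)-\mathrm{diag}_R(i+1))}},$$ where $s_iR$ is $R$ with $i$ and $i+1$ exchanged, and $v_{s_iR}=0$ if $s_iR$ is not standard. Then there is exactly one $H(\mathcal Y)$-module structure on $S$ that is compatible with its $\mathcal K$-vector space structure, extends this action of $T_1,\dots,T_{n-1}$ and in which $Y_1$ acts as the identity. Denote this module by $\mathrm{Rect}(k^N)$. The induced module $$M(k^N)=\mathbb H_{q,t}(GL_n)\otimes_{H(\mathcal Y)}\mathrm{Rect}(k^N)$$ has a unique simple quotient: there is exactly one submodule $W\subseteq M(k^N)$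 such that $M(k^N)/W$ is simple. -/

import Mathlib

open scoped TensorProduct

/-! ### The double affine Hecke algebra of `GL_n` -/

namespace DAHA

/-- Generators of the double affine Hecke algebra.  All indices are taken modulo `n`: `T i` is
`T_i` for `i = 0, …, n - 1`, and `Y i` is `Y_i` for `i = 1, …, n`, so that `Y 0` stands for `Y_n`.
-/
inductive Gen (n : ℕ) : Type
  | T (i : ZMod n)
  | pi
  | piInv
  | Y (i : ZMod n)
  | YInv (i : ZMod n)

variable {K : Type*} [Field K]

/-- The generators as elements of the free algebra. -/
abbrev gen (K : Type*) [Field K] {n : ℕ} (g : Gen n) : FreeAlgebra K (Gen n) := FreeAlgebra.ι K g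

/-- Scalars as elements of the free algebra. -/
abbrev scal (n : ℕ) (c : K) : FreeAlgebra K (Gen n) := algebraMap K _ c

open Gen in
/-- The defining relations of the double affine Hecke algebra of `GL_n`.  The braid and commutation
relations among the `T_i` are dropped for `n = 2`. -/
inductive Rel (n : ℕ) (q t : Kˣ) : FreeAlgebra K (Gen n) → FreeAlgebra K (Gen n) → Prop
  | pi_mul_piInv : Rel n q t (gen K pi * gen K piInv) 1
  | piInv_mul_pi : Rel n q t (gen K piInv * gen K pi) 1
  | Y_mul_YInv (i : ZMod n) : Rel n q t (gen K (Y i) * gen K (YInv i)) 1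
  | YInv_mul_Y (i : ZMod n) : Rel n q t (gen K (YInv i) * gen K (Y i)) 1
  | Y_comm (i j : ZMod n) : Rel n q t (gen K (Y i) * gen K (Y j)) (gen K (Y j) * gen K (Y i))
  | hecke (i : ZMod n) :
      Rel n q t ((gen K (T i) - scal n (t : K)) * (gen K (T i) + scal n (t : K)⁻¹)) 0
  | braid (hn : n ≠ 2) (i : ZMod n) :
      Rel n q t (gen K (T i) * gen K (T (i + 1)) * gen K (T i))
        (gen K (T (i + 1)) * gen K (T i) * gen K (T (i + 1)))
  | T_comm (hn : n ≠ 2) (i j : ZMod n) (h₁ : j ≠ i + 1) (h₂ : j ≠ i - 1) :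
      Rel n q t (gen K (T i) * gen K (T j)) (gen K (T j) * gen K (T i))
  | pi_T (i : ZMod n) :
      Rel n q t (gen K pi * gen K (T i) * gen K piInv) (gen K (T (i + 1)))
  | T_Y_T (i : ZMod n) (hi : i ≠ 0) :
      Rel n q t (gen K (T i) * gen K (Y i) * gen K (T i)) (gen K (Y (i + 1)))
  | T_Y_T_zero :
      Rel n q t (gen K (T 0) * gen K (Y 0) * gen K (T 0)) (scal n (q : K)⁻¹ * gen K (Y 1))
  | T_Y_comm (i j : ZMod n) (h₁ : j ≠ i) (h₂ : j ≠ i + 1) :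
      Rel n q t (gen K (T i) * gen K (Y j)) (gen K (Y j) * gen K (T i))
  | pi_Y (i : ZMod n) (hi : i ≠ 0) :
      Rel n q t (gen K pi * gen K (Y i) * gen K piInv) (gen K (Y (i + 1)))
  | pi_Y_zero :
      Rel n q t (gen K pi * gen K (Y 0) * gen K piInv) (scal n (q : K)⁻¹ * gen K (Y 1))

/-- The double affine Hecke algebra `ℍ_{q,t}(GL_n)`. -/
abbrev Alg (n : ℕ) (q t : Kˣ) : Type _ := RingQuot (Rel n q t)

/-- The image of a generator in the double affine Hecke algebra. -/
def of (n : ℕ) (q t : Kˣ) (g : Gen n) : Alg n q t := RingQuot.mkAlgHom K (Rel n q t) (gen K g)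

/-- The generators `T_1, …, T_{n-1}, Y_1^{±1}, …, Y_n^{±1}`. -/
def affineGens (n : ℕ) (q t : Kˣ) : Set (Alg n q t) :=
  {x | (∃ i : ZMod n, i ≠ 0 ∧ x = of n q t (Gen.T i)) ∨
    (∃ i : ZMod n, x = of n q t (Gen.Y i)) ∨ ∃ i : ZMod n, x = of n q t (Gen.YInv i)}

/-- The affine Hecke subalgebra `H(𝒴)` of the double affine Hecke algebra, generated by
`T_1, …, T_{n-1}, Y_1^{±1}, …, Y_n^{±1}`. -/
def affineHecke (n : ℕ) (q t : Kˣ) : Subalgebra K (Alg n q t) :=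
  Algebra.adjoin K (affineGens n q t)

/-- The element `T_i`, `i ≠ 0`, of `H(𝒴)`. -/
def affineHecke.T (n : ℕ) (q t : Kˣ) (i : ZMod n) (hi : i ≠ 0) : affineHecke n q t :=
  ⟨of n q t (Gen.T i), Algebra.subset_adjoin (Or.inl ⟨i, hi, rfl⟩)⟩

/-- The element `Y_i` of `H(𝒴)`. -/
def affineHecke.Y (n : ℕ) (q t : Kˣ) (i : ZMod n) : affineHecke n q t :=
  ⟨of n q t (Gen.Y i), Algebra.subset_adjoin (Or.inr (Or.inl ⟨i, rfl⟩))⟩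

end DAHA

/-! ### Induced modules -/

/-- The submodule by which `A ⊗_K V` is divided to form `A ⊗_B V`. -/
def inducedRel {K A V : Type*} [Field K] [Ring A] [Algebra K A] [AddCommGroup V] [Module K V]
    {B : Subalgebra K A} (ρ : B →ₐ[K] Module.End K V) : Submodule A (A ⊗[K] V) :=
  Submodule.span A {x | ∃ (b : B) (v : V), x = (b : A) ⊗ₜ[K] v - (1 : A) ⊗ₜ[K] ρ b v}

/-- The induced `A`-module `A ⊗_B V` of a representation `ρ` of a subalgebra `B` on `V`. -/
abbrev Induced {K A V : Type*} [Field K] [Ring A] [Algebra K A] [AddCommGroup V] [Module K V]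
    {B : Subalgebra K A} (ρ : B →ₐ[K] Module.End K V) : Type _ :=
  (A ⊗[K] V) ⧸ inducedRel ρ

/-! ### Rectangular tableaux and the rectangular representation -/

/-- A filling of the `N × k` rectangle by `n = N k` labels is standard if it increases along rows
and down columns.  The labels `1, …, n` are represented by `0, …, n - 1`. -/
def IsStandardFilling {N k : ℕ} (R : Fin N × Fin k ≃ Fin (N * k)) : Prop :=
  (∀ a, StrictMono fun b => R (a, b)) ∧ ∀ b, StrictMono fun a => R (a, b)

/-- Standard Young tableaux of the rectangular shape `(k^N)`, with `N` rows and `k` columns. -/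
abbrev RectSYT (N k : ℕ) : Type :=
  {R : Fin N × Fin k ≃ Fin (N * k) // IsStandardFilling R}

/-- The content (column minus row) of the box that contains a given label. -/
def RectSYT.diag {N k : ℕ} (R : RectSYT N k) (i : Fin (N * k)) : ℤ :=
  ((R.1.symm i).2 : ℤ) - ((R.1.symm i).1 : ℤ)

/-- The vector space with basis `v_R` indexed by the standard Young tableaux of shape `(k^N)`. -/
abbrev RectSpace (K : Type*) [Field K] (N k : ℕ) : Type _ := RectSYT N k →₀ K

open Classical in
/-- The basis vector `v_R` of a filling `R`, read as `0` if `R` is not standard. -/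
noncomputable def rectBasis (K : Type*) [Field K] {N k : ℕ} (R : Fin N × Fin k ≃ Fin (N * k)) :
    RectSpace K N k :=
  if h : IsStandardFilling R then Finsupp.single ⟨R, h⟩ 1 else 0

/-- The diagonal coefficient `(t - t⁻¹) / (1 - t^{2 (diag_R(i) - diag_R(j))})` of the seminormal
form. -/
noncomputable def seminormalCoeff {K : Type*} [Field K] {N k : ℕ} (t : Kˣ) (R : RectSYT N k)
    (i j : Fin (N * k)) : K :=
  ((t : K) - (t : K)⁻¹) / (1 - (t : K) ^ (2 * (R.diag i - R.diag j)))

/-- Young's seminormal form, for the finite Hecke algebra with `(T - t)(T + t⁻¹) = 0`, of the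
irreducible representation attached to the partition `(k^N)`: the generator that exchanges the
consecutive labels `i` and `j = i + 1` acts by `v_R ↦ c v_R + (t⁻¹ + c) v_{s R}`, where `c` is
`seminormalCoeff` and `s R` is `R` with the labels `i` and `j` exchanged.  It acts by `t` on `v_R`
if `i`, `j` lie in one row of `R` and by `-t⁻¹` if they lie in one column. -/
noncomputable def seminormalT {K : Type*} [Field K] (N k : ℕ) (t : Kˣ) (i j : Fin (N * k)) :
    Module.End K (RectSpace K N k) :=
  Finsupp.linearCombination K fun R : RectSYT N k =>
    seminormalCoeff t R i j • rectBasis K R.1 +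
      ((t : K)⁻¹ + seminormalCoeff t R i j) • rectBasis K (R.1.trans (Equiv.swap i j))

theorem natCast_succ_ne_zero_of_lt {n i : ℕ} (h : i + 1 < n) : ((i + 1 : ℕ) : ZMod n) ≠ 0 := by
  rw [Ne, ZMod.natCast_eq_zero_iff]
  exact fun hd => absurd (Nat.le_of_dvd (Nat.succ_pos i) hd) (by omega)

/-- A representation of `H(𝒴)` on `RectSpace K N k` is the rectangular representation if it is the
inflation of the irreducible representation `(k^N)` of the finite Hecke algebra along
`T_i ↦ T_i`, `Y_1 ↦ 1`.  Here `T_{i+1}` exchanges the labels `i + 1` and `i + 2`, represented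
by `i` and `i + 1`. -/
def IsRectangular {K : Type*} [Field K] {N k : ℕ} {q t : Kˣ}
    (ρ : DAHA.affineHecke (N * k) q t →ₐ[K] Module.End K (RectSpace K N k)) : Prop :=
  (∀ (i : ℕ) (hi : i + 1 < N * k),
    ρ (DAHA.affineHecke.T (N * k) q t ((i + 1 : ℕ) : ZMod (N * k))
        (natCast_succ_ne_zero_of_lt hi)) =
      seminormalT N k t ⟨i, Nat.lt_of_succ_lt hi⟩ ⟨i + 1, hi⟩) ∧
  ρ (DAHA.affineHecke.Y (N * k) q t 1) = 1

/-! The double affine Hecke algebra acts on the span of the standard fillings of an infinite strip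
with `N` rows that are periodic, with `n` labels per `k` columns. The action is a seminormal form:
`T_i` mixes a filling with its image under the periodic exchange of two neighbouring labels, `Y_j`
multiplies a filling by `t^(2c)`, where `c` is the content of the box of the corresponding label,
and `π` translates the labels. One period raises contents by `k`, which is what `q = t^(-2k)` asks
for. As `t` is not a root of unity, the denominators do not vanish, and the relations come down to a
few identities between the coefficients (`stripGen_rel`).

A tableau of shape `(k^N)` extends periodically to the strip. The span of these extensions is stable
under `H(𝒴)`, which gives the module structure on `S` (`exists_isRectangular`); it is unique because
`T_i Y_i T_i = Y_{i+1}` computes every `Y_i` from `Y_1`. By Frobenius reciprocity `M(k^N)` maps to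
the strip, injectively on `S`, so the vectors `v_R` do not vanish in `M(k^N)`.

For the simple quotient, cut the strip into rectangles with `k` columns. The module is spanned by
words `T_{i₁} ⋯ T_{iᵣ} π^d v_R` in which every letter exchanges labels of different rectangles in
increasing order; they play the role of minimal coset representatives. An exchange lemma
(`exists_eq_intT_smul`) shows that `T_i` maps a word to a combination of words that are longer by at
most one letter. It follows that `Y_j` is triangular with respect to length, and its diagonal entry
is the weight of the filling that belongs to the word (`IsWord.intY_smul_sub_mem`). This filling
need only be standard inside each rectangle. Nevertheless, if it has the contents of a tableau `R`,
then its labels lie in their original rectangles, and the word is `v_R` itself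
(`IsWord.eq_of_content`). So for every vector `u` some polynomial in the `Y_j` maps `u` to the line
of `v_R` and multiplies `v_R` by a nonzero scalar (`exists_projection`).

Finally, the vector `v₀` of the row reading tableau generates the module
(`rect_mem_of_rowReading_mem`). A submodule that meets the line of `v₀` nontrivially is therefore
everything, so these polynomials annihilate the vectors of proper submodules. The vectors all of
whose multiples can be annihilated in this way form the largest proper submodule, which is the only
maximal one. -/

/-! ### Periodic transpositions of the integers -/

/-- The permutation of `ℤ` that exchanges `j` and `j + 1` for all `j ≡ i` modulo `n`, as a map. -/
def perSwapFun (n : ℕ) (i j : ℤ) : ℤ :=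
  if (n : ℤ) ∣ j - i then j + 1 else if (n : ℤ) ∣ j - (i + 1) then j - 1 else j

theorem not_dvd_one_of_two_le {n : ℕ} (h : 2 ≤ n) : ¬ (n : ℤ) ∣ 1 := fun hd => by
  have := Int.le_of_dvd one_pos hd
  omega

theorem perSwapFun_involutive {n : ℕ} (h : 2 ≤ n) (i : ℤ) :
    Function.Involutive (perSwapFun n i) := by
  have h1 := not_dvd_one_of_two_le h
  intro j
  unfold perSwapFun
  by_cases hj : (n : ℤ) ∣ j - i
  · have h2 : ¬ (n : ℤ) ∣ j + 1 - i := fun hd => h1 (by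
      have := dvd_sub hd hj
      ring_nf at this
      exact this)
    simp [hj, h2]
  · by_cases hj' : (n : ℤ) ∣ j - (i + 1)
    · have h2 : (n : ℤ) ∣ j - 1 - i := by
        convert hj' using 1
        ring
      simp [hj, hj', h2]
    · simp [hj, hj']

/-- The permutation of `ℤ` that exchanges `j` and `j + 1` for all `j ≡ i` modulo `n`; the identity
if `n ≤ 1`. -/
def perSwap (n : ℕ) (i : ℤ) : Equiv.Perm ℤ :=
  if h : 2 ≤ n then (perSwapFun_involutive h i).toPerm else 1

section PerSwap

variable {n : ℕ} (h : 2 ≤ n)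
include h

theorem perSwap_apply (i j : ℤ) : perSwap n i j =
    if (n : ℤ) ∣ j - i then j + 1 else if (n : ℤ) ∣ j - (i + 1) then j - 1 else j := by
  rw [perSwap, dif_pos h]
  rfl

theorem perSwap_self (i : ℤ) : perSwap n i i = i + 1 := by
  simp [perSwap_apply h]

theorem perSwap_succ (i : ℤ) : perSwap n i (i + 1) = i := by
  simp [perSwap_apply h, not_dvd_one_of_two_le h]

theorem perSwap_perSwap (i j : ℤ) : perSwap n i (perSwap n i j) = j := by
  rw [perSwap, dif_pos h]
  exact perSwapFun_involutive h i j

end PerSwap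

theorem perSwap_of_not_dvd {n : ℕ} {i j : ℤ} (h₁ : ¬ (n : ℤ) ∣ j - i)
    (h₂ : ¬ (n : ℤ) ∣ j - (i + 1)) : perSwap n i j = j := by
  by_cases h : 2 ≤ n
  · simp [perSwap_apply h, h₁, h₂]
  · simp [perSwap, h]

theorem perSwap_add_mul (n : ℕ) (i j c : ℤ) : perSwap n i (j + n * c) = perSwap n i j + n * c := by
  by_cases h : 2 ≤ n
  · have e1 : j + n * c - i = j - i + n * c := by ring
    have e2 : j + n * c - (i + 1) = j - (i + 1) + n * c := by ring
    rw [perSwap_apply h, perSwap_apply h, e1, e2]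
    simp only [dvd_add_left (dvd_mul_right (n : ℤ) c)]
    split_ifs <;> ring
  · simp [perSwap, h]

theorem perSwap_congr {n : ℕ} {i j : ℤ} (h : (n : ℤ) ∣ i - j) : perSwap n i = perSwap n j := by
  by_cases hn : 2 ≤ n
  · ext x
    rw [perSwap_apply hn, perSwap_apply hn]
    have e1 : x - j = x - i + (i - j) := by ring
    have e2 : x - (j + 1) = x - (i + 1) + (i - j) := by ring
    rw [e1, e2]
    simp only [dvd_add_left h]
  · simp [perSwap, hn]

theorem perSwap_add_shift (n : ℕ) (i j d : ℤ) :
    perSwap n (i + d) (j + d) = perSwap n i j + d := by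
  by_cases hn : 2 ≤ n
  · rw [perSwap_apply hn, perSwap_apply hn]
    have e1 : j + d - (i + d) = j - i := by ring
    have e2 : j + d - (i + d + 1) = j - (i + 1) := by ring
    rw [e1, e2]
    split_ifs <;> ring
  · simp [perSwap, hn]

/-- Labels move by at most one, so the order can fail only for `b - a ≤ 2`. Distance two with both
labels moving inwards would force `n ∣ 1`, and at distance one only an exchanged pair is reversed.
-/
theorem perSwap_lt_perSwap {n : ℕ} {i a b : ℤ} (hab : a < b)
    (hne : ¬ (b = a + 1 ∧ (n : ℤ) ∣ a - i)) : perSwap n i a < perSwap n i b := by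
  by_cases hn : 2 ≤ n
  · have h1 := not_dvd_one_of_two_le hn
    rw [perSwap_apply hn, perSwap_apply hn]
    have key : (n : ℤ) ∣ a - i → (n : ℤ) ∣ b - (i + 1) → b ≠ a + 2 := by
      rintro ha hb rfl
      refine h1 ?_
      have := dvd_sub hb ha
      ring_nf at this
      exact this
    have h3 : (n : ℤ) ∣ a - i → b ≠ a + 1 := fun h2 h => hne ⟨h, h2⟩
    have h4 : (n : ℤ) ∣ b - (i + 1) → ¬ (n : ℤ) ∣ a - i → b ≠ a + 1 := by
      rintro h7 h2 rfl
      exact h2 (by convert h7 using 1; ring)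
    by_cases ha : (n : ℤ) ∣ a - i
    · have := h3 ha
      by_cases hb : (n : ℤ) ∣ b - (i + 1)
      · have := key ha hb
        split_ifs <;> omega
      · split_ifs <;> omega
    · by_cases hb : (n : ℤ) ∣ b - (i + 1)
      · have := h4 hb ha
        split_ifs <;> omega
      · split_ifs <;> omega
  · simpa [perSwap, hn] using hab

theorem not_dvd_two_of_three_le {n : ℕ} (h : 3 ≤ n) : ¬ (n : ℤ) ∣ 2 := fun hd => by
  have := Int.le_of_dvd two_pos hd
  omega

section PerSwapTriple

variable {n : ℕ} (h : 3 ≤ n)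
include h

theorem perSwap_add_two (i : ℤ) : perSwap n i (i + 1 + 1) = i + 1 + 1 :=
  perSwap_of_not_dvd (by ring_nf; exact not_dvd_two_of_three_le h)
    (by ring_nf; exact not_dvd_one_of_two_le (by omega))

theorem perSwap_succ_self (i : ℤ) : perSwap n (i + 1) i = i :=
  perSwap_of_not_dvd (by ring_nf; simpa using not_dvd_one_of_two_le (by omega : 2 ≤ n))
    (by ring_nf; simpa using not_dvd_two_of_three_le h)

/-- By periodicity only the residues of `i`, `i + 1`, `i + 2` matter, and they are distinct for `n ≥
3`. -/
theorem perSwap_braid (i j : ℤ) : perSwap n i (perSwap n (i + 1) (perSwap n i j)) =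
    perSwap n (i + 1) (perSwap n i (perSwap n (i + 1) j)) := by
  have h2 : 2 ≤ n := by omega
  by_cases h0 : (n : ℤ) ∣ j - i
  · obtain ⟨c, hc⟩ := h0
    obtain rfl : j = i + n * c := by linarith
    simp only [perSwap_add_mul, perSwap_self h2, perSwap_add_two h, perSwap_succ_self h]
  by_cases h1 : (n : ℤ) ∣ j - (i + 1)
  · obtain ⟨c, hc⟩ := h1
    obtain rfl : j = i + 1 + n * c := by linarith
    simp only [perSwap_add_mul, perSwap_self h2, perSwap_succ h2, perSwap_add_two h,
      perSwap_succ_self h]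
  by_cases h3 : (n : ℤ) ∣ j - (i + 1 + 1)
  · obtain ⟨c, hc⟩ := h3
    obtain rfl : j = i + 1 + 1 + n * c := by linarith
    simp only [perSwap_add_mul, perSwap_succ h2, perSwap_add_two h, perSwap_succ_self h]
  · simp only [perSwap_of_not_dvd h0 h1, perSwap_of_not_dvd h1 h3]

end PerSwapTriple

theorem perSwap_of_far {n : ℕ} {i j : ℤ} (h0 : ¬ (n : ℤ) ∣ j - i)
    (h1 : ¬ (n : ℤ) ∣ j - (i + 1)) (h2 : ¬ (n : ℤ) ∣ i - (j + 1)) :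
    perSwap n i j = j ∧ perSwap n i (j + 1) = j + 1 ∧ perSwap n j i = i ∧
      perSwap n j (i + 1) = i + 1 := by
  have h0' : ¬ (n : ℤ) ∣ i - j := fun h => h0 (by simpa using h.neg_right)
  have h2' : ¬ (n : ℤ) ∣ j + 1 - i := fun h => h2 (by simpa using h.neg_right)
  have h1' : ¬ (n : ℤ) ∣ i + 1 - j := fun h => h1 (by simpa using h.neg_right)
  refine ⟨perSwap_of_not_dvd h0 h1, perSwap_of_not_dvd h2' ?_, perSwap_of_not_dvd h0' h2,
    perSwap_of_not_dvd h1' ?_⟩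
  · simpa using h0
  · simpa using h0'

theorem perSwap_comm {n : ℕ} (hn : 2 ≤ n) {i j : ℤ} (h0 : ¬ (n : ℤ) ∣ j - i)
    (h1 : ¬ (n : ℤ) ∣ j - (i + 1)) (h2 : ¬ (n : ℤ) ∣ i - (j + 1)) (x : ℤ) :
    perSwap n i (perSwap n j x) = perSwap n j (perSwap n i x) := by
  obtain ⟨e1, e2, e3, e4⟩ := perSwap_of_far h0 h1 h2
  by_cases a0 : (n : ℤ) ∣ x - i
  · obtain ⟨c, hc⟩ := a0
    obtain rfl : x = i + n * c := by linarith
    simp only [perSwap_add_mul, perSwap_self hn, e3, e4]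
  by_cases a1 : (n : ℤ) ∣ x - (i + 1)
  · obtain ⟨c, hc⟩ := a1
    obtain rfl : x = i + 1 + n * c := by linarith
    simp only [perSwap_add_mul, perSwap_succ hn, e3, e4]
  by_cases b0 : (n : ℤ) ∣ x - j
  · obtain ⟨c, hc⟩ := b0
    obtain rfl : x = j + n * c := by linarith
    simp only [perSwap_add_mul, perSwap_self hn, e1, e2]
  by_cases b1 : (n : ℤ) ∣ x - (j + 1)
  · obtain ⟨c, hc⟩ := b1
    obtain rfl : x = j + 1 + n * c := by linarith
    simp only [perSwap_add_mul, perSwap_succ hn, e1, e2]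
  · simp only [perSwap_of_not_dvd a0 a1, perSwap_of_not_dvd b0 b1]

/-! ### Fillings of the infinite strip -/

/-- A filling of the strip with `N` rows and infinitely many columns by the integers, recorded by
the map that sends a label to its box. -/
abbrev StripFilling (N : ℕ) : Type := ℤ ≃ Fin N × ℤ

namespace StripFilling

variable {N : ℕ}

/-- The content (column minus row) of the box that contains a given label. -/
def content (G : StripFilling N) (j : ℤ) : ℤ := (G j).2 - ((G j).1 : ℤ)

/-- The labels `j + n` and `j` lie in the same row, at distance `k`. -/
def IsPeriodic (n k : ℕ) (G : StripFilling N) : Prop := ∀ j, G (j + n) = ((G j).1, (G j).2 + k)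

/-- A filling is standard if it is periodic and increases along rows and down columns. -/
def IsStandard (n k : ℕ) (G : StripFilling N) : Prop :=
  G.IsPeriodic n k ∧ ∀ i j, G i ≤ G j → i ≤ j

/-- The exchange of the labels `j` and `j + 1` for all `j ≡ i` modulo `n`. -/
def swap (n : ℕ) (i : ℤ) (G : StripFilling N) : StripFilling N := (perSwap n i).trans G

/-- The translation of all labels by `d`. -/
def shift (d : ℤ) (G : StripFilling N) : StripFilling N := (Equiv.subRight d).trans G

@[simp] theorem swap_apply (n : ℕ) (i j : ℤ) (G : StripFilling N) :
    G.swap n i j = G (perSwap n i j) := rfl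

@[simp] theorem shift_apply (d j : ℤ) (G : StripFilling N) : G.shift d j = G (j - d) := rfl

theorem content_swap (n : ℕ) (i j : ℤ) (G : StripFilling N) :
    (G.swap n i).content j = G.content (perSwap n i j) := rfl

theorem content_shift (d j : ℤ) (G : StripFilling N) :
    (G.shift d).content j = G.content (j - d) := rfl

theorem shift_shift (d e : ℤ) (G : StripFilling N) : (G.shift d).shift e = G.shift (d + e) := by
  ext1 j
  simp only [shift_apply]
  congr 1
  ring

theorem shift_zero (G : StripFilling N) : G.shift 0 = G := by
  ext1 j
  simp

theorem swap_swap {n : ℕ} (h : 2 ≤ n) (i : ℤ) (G : StripFilling N) :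
    (G.swap n i).swap n i = G := by
  ext1 j
  simp [perSwap_perSwap h]

theorem swap_congr {n : ℕ} {i j : ℤ} (h : (n : ℤ) ∣ i - j) (G : StripFilling N) :
    G.swap n i = G.swap n j := by
  rw [swap, perSwap_congr h, swap]

theorem swap_shift (n : ℕ) (i d : ℤ) (G : StripFilling N) :
    (G.swap n i).shift d = (G.shift d).swap n (i + d) := by
  ext1 j
  simp only [swap_apply, shift_apply]
  congr 1
  have := perSwap_add_shift n i (j - d) d
  rw [sub_add_cancel] at this
  rw [this, add_sub_cancel_right]

variable {n k : ℕ} {G : StripFilling N}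

theorem IsPeriodic.apply_add_mul (hG : G.IsPeriodic n k) (j c : ℤ) :
    G (j + n * c) = ((G j).1, (G j).2 + k * c) := by
  induction c with
  | zero => simp
  | succ c ih =>
    rw [mul_add, ← add_assoc, mul_one, hG, ih]
    ext
    · rfl
    · simp only
      ring
  | pred c ih =>
    have := hG (j + n * (-c - 1))
    rw [add_assoc, ← mul_add_one, sub_add_cancel, ih, Prod.ext_iff] at this
    ext
    · rw [← this.1]
    · simp only at this ⊢
      linarith [this.2]

theorem IsPeriodic.content_add_mul (hG : G.IsPeriodic n k) (j c : ℤ) :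
    G.content (j + n * c) = G.content j + k * c := by
  simp only [content, hG.apply_add_mul]
  ring

theorem IsPeriodic.swap (hG : G.IsPeriodic n k) (i : ℤ) : (G.swap n i).IsPeriodic n k := by
  intro j
  have := perSwap_add_mul n i j 1
  rw [mul_one] at this
  simp only [swap_apply, this]
  exact hG _

theorem IsPeriodic.shift (hG : G.IsPeriodic n k) (d : ℤ) : (G.shift d).IsPeriodic n k := by
  intro j
  simp only [shift_apply]
  rw [← hG]
  congr 1
  ring

theorem IsStandard.shift (hG : G.IsStandard n k) (d : ℤ) : (G.shift d).IsStandard n k :=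
  ⟨hG.1.shift d, fun i j hij => by simpa using hG.2 _ _ hij⟩

/-- Two boxes are comparable if one of them lies weakly to the lower right of the other. -/
def Comparable (a b : Fin N × ℤ) : Prop := a ≤ b ∨ b ≤ a

theorem Comparable.symm {a b : Fin N × ℤ} (h : Comparable a b) : Comparable b a := Or.symm h

theorem comparable_comm {a b : Fin N × ℤ} : Comparable a b ↔ Comparable b a := Or.comm

theorem comparable_of_add {a b : Fin N × ℤ} (c : ℤ)
    (h : Comparable (a.1, a.2 + c) (b.1, b.2 + c)) : Comparable a b := by
  simpa [Comparable, Prod.le_def] using h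

/-- The only pairs of labels whose order changes are the translates of `i, i + 1`, and their boxes
are not related by the order. -/
theorem IsStandard.swap (hG : G.IsStandard n k) {i : ℤ} (hi : ¬ Comparable (G i) (G (i + 1))) :
    (G.swap n i).IsStandard n k := by
  refine ⟨hG.1.swap i, fun a b hab => ?_⟩
  by_cases hn : 2 ≤ n
  · simp only [swap_apply] at hab
    by_contra! hlt
    by_cases hc : a = b + 1 ∧ (n : ℤ) ∣ b - i
    · obtain ⟨rfl, c, hc⟩ := hc
      obtain rfl : b = i + n * c := by linarith
      rw [perSwap_add_mul, perSwap_self hn, show i + n * c + 1 = i + 1 + n * c by ring,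
        perSwap_add_mul, perSwap_succ hn, hG.1.apply_add_mul, hG.1.apply_add_mul] at hab
      exact hi (comparable_of_add _ (Or.inl hab))
    · have h1 := perSwap_lt_perSwap hlt hc
      have h2 := hG.2 _ _ hab
      omega
  · have : G.swap n i = G := by
      ext1 j
      simp [perSwap, hn]
    rw [this] at hab
    exact hG.2 _ _ hab

theorem not_isStandard_swap (hn : 2 ≤ n) (hG : G.IsStandard n k) {i : ℤ}
    (hi : Comparable (G i) (G (i + 1))) : ¬ (G.swap n i).IsStandard n k := by
  intro hs
  have h1 := hG.2 i (i + 1)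
  rcases hi with hi | hi
  · have := hs.2 (i + 1) i (by simpa [perSwap_self hn, perSwap_succ hn] using hi)
    omega
  · have := hG.2 _ _ hi
    omega

theorem IsStandard.of_swap {i : ℤ} (hs : (G.swap n i).IsStandard n k)
    (hi : ¬ Comparable (G i) (G (i + 1))) : G.IsStandard n k := by
  by_cases hn : 2 ≤ n
  · rw [← swap_swap hn i G]
    refine hs.swap ?_
    simpa [perSwap_self hn, perSwap_succ hn, comparable_comm] using hi
  · have : G.swap n i = G := by
      ext1 j
      simp [perSwap, hn]
    rwa [this] at hs

theorem IsStandard.lt_of_lt (hG : G.IsStandard n k) {i j : ℤ} (h : G i < G j) : i < j :=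
  lt_of_le_of_ne (hG.2 _ _ h.le) fun he => h.ne (by rw [he])

/-- Consecutive labels in comparable boxes lie in adjacent boxes. -/
theorem IsStandard.content_of_comparable (hG : G.IsStandard n k) {i : ℤ}
    (hi : Comparable (G i) (G (i + 1))) :
    G.content i - G.content (i + 1) = 1 ∨ G.content i - G.content (i + 1) = -1 := by
  have hle : G i ≤ G (i + 1) := by
    rcases hi with hi | hi
    · exact hi
    · have := hG.2 _ _ hi
      omega
  -- A box strictly between the two would carry a label strictly between `i` and `i + 1`.
  have hmid : ∀ c : Fin N × ℤ, G i < c → c < G (i + 1) → False := fun c h1 h2 => by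
    obtain ⟨l, rfl⟩ := G.surjective c
    have := hG.lt_of_lt h1
    have := hG.lt_of_lt h2
    omega
  have hne : G i ≠ G (i + 1) := fun h => by
    have := G.injective h
    omega
  unfold content
  revert hle hmid hne
  generalize G i = a
  generalize G (i + 1) = b
  obtain ⟨r, x⟩ := a
  obtain ⟨s, y⟩ := b
  intro hle hmid hne
  obtain ⟨hrs, hxy⟩ := Prod.mk_le_mk.1 hle
  rcases hrs.lt_or_eq with hrs | rfl
  · rcases hxy.lt_or_eq with hxy | rfl
    · exact (hmid (r, y) (Prod.mk_lt_mk_iff_right.2 hxy) (Prod.mk_lt_mk_iff_left.2 hrs)).elim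
    · by_cases h2 : (r : ℕ) + 1 = s
      · left
        simp only
        omega
      · have h3 : (r : ℕ) + 1 < s := by
          have : (r : ℕ) < s := hrs
          omega
        refine (hmid (⟨r + 1, by omega⟩, x) (Prod.mk_lt_mk_iff_left.2 ?_)
          (Prod.mk_lt_mk_iff_left.2 ?_)).elim
        · rw [Fin.lt_def]
          simp
        · rw [Fin.lt_def]
          exact h3
  · have hxy : x < y := lt_of_le_of_ne hxy fun h => hne (by rw [h])
    by_cases h2 : x + 1 = y
    · right
      simp only
      omega
    · refine (hmid (r, x + 1) (Prod.mk_lt_mk_iff_right.2 ?_) (Prod.mk_lt_mk_iff_right.2 ?_)).elim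
        <;> omega

/-- Incomparable boxes have contents that differ by at least two. -/
theorem content_of_not_comparable {i j : ℤ} (hi : ¬ Comparable (G i) (G j)) :
    G.content i - G.content j ≤ -2 ∨ 2 ≤ G.content i - G.content j := by
  unfold content
  revert hi
  generalize G i = a
  generalize G j = b
  obtain ⟨r, x⟩ := a
  obtain ⟨s, y⟩ := b
  intro hi
  simp only [Comparable, Prod.mk_le_mk, not_or, not_and_or, Fin.le_def] at hi
  simp only
  omega

theorem IsStandard.content_ne_succ (hG : G.IsStandard n k) (i : ℤ) :
    G.content i - G.content (i + 1) ≠ 0 := by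
  by_cases hi : Comparable (G i) (G (i + 1))
  · have := hG.content_of_comparable hi
    omega
  · have := content_of_not_comparable hi
    omega

/-- Boxes on one diagonal contain labels that differ by at least three. -/
theorem IsStandard.content_ne_add_two (hG : G.IsStandard n k) (i : ℤ) :
    G.content i - G.content (i + 1 + 1) ≠ 0 := by
  by_cases hi : Comparable (G i) (G (i + 1 + 1))
  · have hle : G i ≤ G (i + 1 + 1) := by
      rcases hi with hi | hi
      · exact hi
      · have := hG.2 _ _ hi
        omega
    intro h0
    have hne : G i ≠ G (i + 1 + 1) := fun h => by
      have := G.injective h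
      omega
    have hmid : ∀ c : Fin N × ℤ, G i < c → c < G (i + 1 + 1) → c = G (i + 1) := fun c h1 h2 => by
      obtain ⟨l, rfl⟩ := G.surjective c
      have := hG.lt_of_lt h1
      have := hG.lt_of_lt h2
      congr 1
      omega
    unfold content at h0
    generalize G i = a at *
    generalize G (i + 1 + 1) = b at *
    obtain ⟨r, x⟩ := a
    obtain ⟨s, y⟩ := b
    obtain ⟨hrs, hxy⟩ := Prod.mk_le_mk.1 hle
    have hrs' : r < s := lt_of_le_of_ne hrs fun h => hne (by
      subst h
      simp only at h0
      rw [show x = y by omega])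
    have hxy' : x < y := lt_of_le_of_ne hxy fun h => by
      simp only at h0
      have : (r : ℕ) < s := hrs'
      omega
    -- Two distinct boxes on one diagonal span a rectangle whose other two corners both lie strictly
    -- between them, but only the label `i + 1` is available.
    have e1 := hmid (r, y) (Prod.mk_lt_mk_iff_right.2 hxy') (Prod.mk_lt_mk_iff_left.2 hrs')
    have e2 := hmid (s, x) (Prod.mk_lt_mk_iff_left.2 hrs') (Prod.mk_lt_mk_iff_right.2 hxy')
    rw [← e1] at e2
    exact hrs'.ne (Prod.mk.inj e2).1.symm
  · have := content_of_not_comparable hi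
    omega

end StripFilling

/-! ### The coefficients of the seminormal form -/

section Coefficients

variable {K : Type*} [Field K] (t : Kˣ)

/-- The diagonal coefficient of the seminormal form for boxes whose contents differ by `x`. -/
def contentCoeff (x : ℤ) : K := ((t : K) - (t : K)⁻¹) / (1 - (t : K) ^ (2 * x))

variable {t} (ht : ∀ m : ℕ, 0 < m → t ^ m ≠ 1)
include ht

theorem zpow_two_mul_ne_one {x : ℤ} (hx : x ≠ 0) : (t : K) ^ (2 * x) ≠ 1 := by
  have key : ∀ m : ℕ, 0 < m → (t : K) ^ m ≠ 1 := fun m hm h => ht m hm (by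
    ext
    simpa using h)
  rcases lt_or_gt_of_ne hx with h | h
  · intro h1
    obtain ⟨m, hm⟩ := Int.eq_ofNat_of_zero_le (show 0 ≤ -(2 * x) by omega)
    apply key m (by omega)
    rw [← zpow_natCast, ← hm, zpow_neg, h1, inv_one]
  · obtain ⟨m, hm⟩ := Int.eq_ofNat_of_zero_le (show 0 ≤ 2 * x by omega)
    rw [hm, zpow_natCast]
    exact key m (by omega)

theorem one_sub_zpow_ne_zero {x : ℤ} (hx : x ≠ 0) : 1 - (t : K) ^ (2 * x) ≠ 0 :=
  sub_ne_zero.2 (zpow_two_mul_ne_one ht hx).symm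

theorem contentCoeff_neg {x : ℤ} (hx : x ≠ 0) :
    contentCoeff t (-x) = (t : K) - (t : K)⁻¹ - contentCoeff t x := by
  have h1 := one_sub_zpow_ne_zero ht hx
  have h2 := one_sub_zpow_ne_zero ht (neg_ne_zero.2 hx)
  have h3 : (t : K) ^ (2 * x) ≠ 0 := zpow_ne_zero _ t.ne_zero
  unfold contentCoeff
  rw [mul_neg, zpow_neg] at *
  have h4 : 1 - ((t : K) ^ (2 * x))⁻¹ = -(1 - (t : K) ^ (2 * x)) / (t : K) ^ (2 * x) := by
    field_simp
    ring
  rw [h4]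
  field_simp
  ring

/-- This is the identity behind the braid relation; `x`, `y`, `x + y` are the content differences of
three successive labels. -/
theorem contentCoeff_mul {x y : ℤ} (hx : x ≠ 0) (hy : y ≠ 0) (hxy : x + y ≠ 0) :
    (contentCoeff t x : K) * contentCoeff t y +
        contentCoeff t (x + y) * ((t : K) - (t : K)⁻¹ - contentCoeff t x) =
      contentCoeff t y * contentCoeff t (x + y) := by
  have h1 := one_sub_zpow_ne_zero ht hx
  have h2 := one_sub_zpow_ne_zero ht hy
  have h3 := one_sub_zpow_ne_zero ht hxy
  unfold contentCoeff
  rw [mul_add, zpow_add₀ t.ne_zero] at *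
  generalize (t : K) ^ (2 * x) = u at *
  generalize (t : K) ^ (2 * y) = v at *
  generalize (t : K) - (t : K)⁻¹ = w
  field_simp
  ring

/-- This is the identity behind `T_i Y_i T_i = Y_{i+1}`: the power of `t` is the quotient of the
weights of two successive labels. -/
theorem contentCoeff_mul_zpow {x : ℤ} (hx : x ≠ 0) :
    contentCoeff t x * (t : K) ^ (2 * x) = contentCoeff t x - ((t : K) - (t : K)⁻¹) := by
  have h1 := one_sub_zpow_ne_zero ht hx
  unfold contentCoeff
  field_simp
  ring

theorem contentCoeff_neg_one : contentCoeff t (-1) = (t : K) := by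
  have h := contentCoeff_mul_zpow ht (show (-1 : ℤ) ≠ 0 by norm_num)
  have h1 := one_sub_zpow_ne_zero ht (show (-1 : ℤ) ≠ 0 by norm_num)
  unfold contentCoeff
  rw [div_eq_iff h1]
  have := t.ne_zero
  norm_num [zpow_ofNat, zpow_neg]
  field_simp

theorem contentCoeff_one : contentCoeff t 1 = -(t : K)⁻¹ := by
  have h := contentCoeff_neg ht (show (1 : ℤ) ≠ 0 by norm_num)
  rw [contentCoeff_neg_one ht] at h
  linear_combination h

/-- The sum equals `t (1 - t^(2(x-1))) / (1 - t^(2x))`. Its nonvanishing makes it possible to pass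
from the vector of a tableau to that of its neighbour. -/
theorem inv_add_contentCoeff_ne_zero {x : ℤ} (hx : x ≠ 0) (hx1 : x ≠ 1) :
    (t : K)⁻¹ + contentCoeff t x ≠ 0 := by
  have h1 := one_sub_zpow_ne_zero ht hx
  have h2 := one_sub_zpow_ne_zero ht (sub_ne_zero.2 hx1)
  have h0 := t.ne_zero
  have h3 : (t : K) ^ (2 * (x - 1)) = (t : K) ^ (2 * x) * ((t : K)⁻¹ * (t : K)⁻¹) := by
    rw [mul_sub, zpow_sub₀ h0]
    norm_num [zpow_ofNat]
    field_simp
  have h4 : (t : K)⁻¹ + contentCoeff t x =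
      t * (1 - (t : K) ^ (2 * (x - 1))) / (1 - (t : K) ^ (2 * x)) := by
    rw [h3]
    unfold contentCoeff
    field_simp
    ring
  rw [h4]
  exact div_ne_zero (mul_ne_zero h0 h2) h1

end Coefficients

/-! ### The representation on the standard fillings of the strip -/

/-- The vector space with basis the standard fillings of the strip. -/
abbrev StripSpace (K : Type*) [Field K] (N n k : ℕ) : Type _ :=
  {G : StripFilling N // G.IsStandard n k} →₀ K

open Classical in
/-- The basis vector of a filling of the strip, read as `0` if the filling is not standard. -/
noncomputable def stripBasis (K : Type*) [Field K] {N : ℕ} (n k : ℕ) (G : StripFilling N) :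
    StripSpace K N n k :=
  if h : G.IsStandard n k then Finsupp.single ⟨G, h⟩ 1 else 0

/-- The content (column minus row) of a box of the strip. -/
def boxContent {N : ℕ} (a : Fin N × ℤ) : ℤ := a.2 - (a.1 : ℤ)

section StripRep

open StripFilling

variable {K : Type*} [Field K] {N : ℕ} (n k : ℕ) (t : Kˣ)

/-- The diagonal coefficient of the seminormal form for two boxes. -/
def diagCoeff (a b : Fin N × ℤ) : K := contentCoeff t (boxContent a - boxContent b)

open Classical in
/-- The off-diagonal coefficient of the seminormal form for two boxes. -/
noncomputable def offCoeff (a b : Fin N × ℤ) : K :=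
  if Comparable a b then 0 else (t : K)⁻¹ + diagCoeff t a b

/-- The operator `T` that exchanges the labels `i` and `i + 1` of the strip. -/
noncomputable def stripT (i : ℤ) : Module.End K (StripSpace K N n k) :=
  Finsupp.linearCombination K fun G : {G : StripFilling N // G.IsStandard n k} =>
    diagCoeff t (G.1 i) (G.1 (i + 1)) • stripBasis K n k G.1 +
      offCoeff t (G.1 i) (G.1 (i + 1)) • stripBasis K n k (G.1.swap n i)

/-- The operator that multiplies a filling by the weight of the label `j`. -/
noncomputable def stripY (j : ℤ) : Module.End K (StripSpace K N n k) :=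
  Finsupp.linearCombination K fun G : {G : StripFilling N // G.IsStandard n k} =>
    ((t : K) ^ (2 * G.1.content j)) • stripBasis K n k G.1

variable (K N) in
/-- The operator that translates all labels of the strip by `d`. -/
noncomputable def stripShift (d : ℤ) : Module.End K (StripSpace K N n k) :=
  Finsupp.linearCombination K fun G : {G : StripFilling N // G.IsStandard n k} =>
    stripBasis K n k (G.1.shift d)

variable {n k t}

theorem stripBasis_of_isStandard {G : StripFilling N} (h : G.IsStandard n k) :
    stripBasis K n k G = Finsupp.single ⟨G, h⟩ 1 := dif_pos h

theorem stripBasis_of_not_isStandard {G : StripFilling N} (h : ¬ G.IsStandard n k) :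
    stripBasis K n k G = 0 := dif_neg h

theorem stripSpace_hom_ext {V : Type*} [AddCommGroup V] [Module K V]
    {f g : StripSpace K N n k →ₗ[K] V}
    (h : ∀ G : StripFilling N, G.IsStandard n k →
      f (stripBasis K n k G) = g (stripBasis K n k G)) : f = g := by
  refine Finsupp.lhom_ext' fun G => LinearMap.ext_ring ?_
  simpa [stripBasis_of_isStandard G.2] using h G.1 G.2

theorem stripY_basis (j : ℤ) (G : StripFilling N) : stripY n k t j (stripBasis K n k G) =
    ((t : K) ^ (2 * G.content j)) • stripBasis K n k G := by
  by_cases h : G.IsStandard n k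
  · rw [stripBasis_of_isStandard h, stripY, Finsupp.linearCombination_single, one_smul,
      stripBasis_of_isStandard h]
  · rw [stripBasis_of_not_isStandard h, map_zero, smul_zero]

theorem stripShift_basis (d : ℤ) (G : StripFilling N) :
    stripShift K N n k d (stripBasis K n k G) = stripBasis K n k (G.shift d) := by
  by_cases h : G.IsStandard n k
  · rw [stripBasis_of_isStandard h, stripShift, Finsupp.linearCombination_single, one_smul]
  · have h' : ¬ (G.shift d).IsStandard n k := fun hs => h (by
      have := hs.shift (-d)
      rwa [shift_shift, add_neg_cancel, shift_zero] at this)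
    rw [stripBasis_of_not_isStandard h, map_zero, stripBasis_of_not_isStandard h']

/-- Because `offCoeff` vanishes on comparable boxes, the formula also holds for fillings that are
not standard, where both sides are zero. Operators can then be composed without asking which
fillings are standard. -/
theorem stripT_basis (i : ℤ) (G : StripFilling N) : stripT n k t i (stripBasis K n k G) =
    diagCoeff t (G i) (G (i + 1)) • stripBasis K n k G +
      offCoeff t (G i) (G (i + 1)) • stripBasis K n k (G.swap n i) := by
  by_cases h : G.IsStandard n k
  · rw [stripBasis_of_isStandard h, stripT, Finsupp.linearCombination_single, one_smul,
      stripBasis_of_isStandard h]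
  · rw [stripBasis_of_not_isStandard h, map_zero, smul_zero, zero_add, offCoeff]
    split_ifs with hc
    · rw [zero_smul]
    · rw [stripBasis_of_not_isStandard fun hs => h (hs.of_swap hc), smul_zero]

theorem stripT_basis_of_isStandard (hn : 2 ≤ n) (i : ℤ) {G : StripFilling N}
    (hG : G.IsStandard n k) : stripT n k t i (stripBasis K n k G) =
    diagCoeff t (G i) (G (i + 1)) • stripBasis K n k G +
      ((t : K)⁻¹ + diagCoeff t (G i) (G (i + 1))) • stripBasis K n k (G.swap n i) := by
  rw [stripT_basis, offCoeff]
  split_ifs with hc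
  · rw [stripBasis_of_not_isStandard (not_isStandard_swap hn hG hc), smul_zero, smul_zero]
  · rfl

theorem stripT_basis_of_comparable {i : ℤ} {G : StripFilling N}
    (hG : Comparable (G i) (G (i + 1))) : stripT n k t i (stripBasis K n k G) =
    diagCoeff t (G i) (G (i + 1)) • stripBasis K n k G := by
  rw [stripT_basis, offCoeff, if_pos hG, zero_smul, add_zero]

theorem StripFilling.two_le_of_not_comparable {i : ℤ} {G : StripFilling N}
    (hG : G.IsPeriodic n k) (hn : 0 < n) (hi : ¬ Comparable (G i) (G (i + 1))) : 2 ≤ n := by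
  by_contra! h
  obtain rfl : n = 1 := by omega
  refine hi (Or.inl ?_)
  have := hG i
  rw [Nat.cast_one] at this
  rw [this, Prod.le_def]
  simp

/-! ### The Hecke relations for the operators on the strip -/

section Relations

variable (ht : ∀ m : ℕ, 0 < m → t ^ m ≠ 1) (hn : 0 < n)
include ht

theorem diagCoeff_swap {a b : Fin N × ℤ} (h : boxContent a - boxContent b ≠ 0) :
    diagCoeff t b a = (t : K) - (t : K)⁻¹ - diagCoeff t a b := by
  rw [diagCoeff, diagCoeff, ← contentCoeff_neg ht h, neg_sub]

theorem diagCoeff_of_comparable {i : ℤ} {G : StripFilling N} (hG : G.IsStandard n k)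
    (hi : Comparable (G i) (G (i + 1))) :
    (diagCoeff t (G i) (G (i + 1)) : K) = t ∧ G.content (i + 1) = G.content i + 1 ∨
      (diagCoeff t (G i) (G (i + 1)) : K) = -(t : K)⁻¹ ∧
        G.content (i + 1) = G.content i - 1 := by
  have h : (diagCoeff t (G i) (G (i + 1)) : K) =
    contentCoeff t (G.content i - G.content (i + 1)) := rfl
  rcases hG.content_of_comparable hi with h1 | h1
  · rw [h, h1, contentCoeff_one ht]
    exact Or.inr ⟨rfl, by omega⟩
  · rw [h, h1, contentCoeff_neg_one ht]
    exact Or.inl ⟨rfl, by omega⟩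

/-- For comparable boxes the diagonal coefficient is `t` or `-t⁻¹`, so that both sides vanish; thus
the product formula needs no exception. -/
theorem offCoeff_mul_offCoeff {i : ℤ} {G : StripFilling N} (hG : G.IsStandard n k) :
    offCoeff t (G i) (G (i + 1)) * offCoeff t (G (i + 1)) (G i) =
      ((t : K) - diagCoeff t (G i) (G (i + 1))) *
        ((t : K)⁻¹ + diagCoeff t (G i) (G (i + 1))) := by
  by_cases hc : Comparable (G i) (G (i + 1))
  · rw [offCoeff, if_pos hc, zero_mul]
    rcases diagCoeff_of_comparable (K := K) ht hG hc with h | h <;> rw [h.1] <;> ring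
  · rw [offCoeff, offCoeff, if_neg hc, if_neg fun h => hc h.symm,
      diagCoeff_swap ht (hG.content_ne_succ i)]
    ring

include hn

/-- On comparable boxes the operator is the scalar `t` or `-t⁻¹`. Otherwise it acts on the plane of
a filling and its exchange by a matrix of trace `t - t⁻¹` and determinant `-1`. -/
theorem stripT_mul_stripT (i : ℤ) : stripT n k t i * stripT n k t i =
    ((t : K) - (t : K)⁻¹) • stripT (N := N) n k t i + 1 := by
  refine stripSpace_hom_ext fun G hG => ?_
  have h0 : (t : K) ≠ 0 := t.ne_zero
  simp only [Module.End.mul_apply, LinearMap.add_apply, LinearMap.smul_apply, Module.End.one_apply]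
  by_cases hc : Comparable (G i) (G (i + 1))
  · simp only [stripT_basis_of_comparable hc, map_smul, smul_smul]
    rcases diagCoeff_of_comparable (K := K) ht hG hc with h | h <;> rw [h.1] <;>
      match_scalars <;> field_simp <;> ring
  · have h2 := two_le_of_not_comparable hG.1 hn hc
    have hp := offCoeff_mul_offCoeff (K := K) (i := i) ht hG
    have hd := diagCoeff_swap (K := K) ht (hG.content_ne_succ i)
    simp only [stripT_basis, map_smul, map_add, swap_apply, perSwap_self h2, perSwap_succ h2,
      swap_swap h2, hd]
    match_scalars
    · linear_combination hp + mul_inv_cancel₀ h0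
    · ring

theorem stripT_stripY_stripT (i : ℤ) : stripT n k t i * stripY n k t i * stripT n k t i =
    stripY (N := N) n k t (i + 1) := by
  refine stripSpace_hom_ext fun G hG => ?_
  have h0 : (t : K) ≠ 0 := t.ne_zero
  simp only [Module.End.mul_apply]
  by_cases hc : Comparable (G i) (G (i + 1))
  · simp only [stripT_basis_of_comparable hc, map_smul, smul_smul, stripY_basis]
    rcases diagCoeff_of_comparable (K := K) ht hG hc with h | h <;> rw [h.1, h.2] <;>
      simp only [mul_add, mul_sub, zpow_add₀ h0, zpow_sub₀ h0] <;>
      match_scalars <;> norm_num [zpow_ofNat] <;> field_simp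
  · have h2 := two_le_of_not_comparable hG.1 hn hc
    have hp := offCoeff_mul_offCoeff (K := K) (i := i) ht hG
    have hd := diagCoeff_swap (K := K) ht (hG.content_ne_succ i)
    have hz := contentCoeff_mul_zpow (K := K) ht (hG.content_ne_succ i)
    have hz' : diagCoeff t (G i) (G (i + 1)) * (t : K) ^ (2 * G.content i) =
        (diagCoeff t (G i) (G (i + 1)) - ((t : K) - (t : K)⁻¹)) *
          (t : K) ^ (2 * G.content (i + 1)) := by
      have e : (t : K) ^ (2 * G.content i) = (t : K) ^ (2 * (G.content i - G.content (i + 1))) *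
          (t : K) ^ (2 * G.content (i + 1)) := by
        rw [← zpow_add₀ h0]
        congr 1
        ring
      rw [e, ← mul_assoc]
      exact congrArg (· * (t : K) ^ (2 * G.content (i + 1))) hz
    simp only [stripT_basis, map_smul, map_add, swap_apply, perSwap_self h2, perSwap_succ h2,
      swap_swap h2, hd, stripY_basis, content_swap]
    match_scalars
    · linear_combination diagCoeff t (G i) (G (i + 1)) * hz' +
        (t : K) ^ (2 * G.content (i + 1)) * (hp + mul_inv_cancel₀ h0)
    · linear_combination offCoeff t (G i) (G (i + 1)) * hz'

omit hn in
theorem stripT_braid (h3 : 3 ≤ n) (i : ℤ) :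
    stripT n k t i * stripT n k t (i + 1) * stripT n k t i =
      stripT n k t (i + 1) * stripT n k t i * stripT (K := K) (N := N) n k t (i + 1) := by
  refine stripSpace_hom_ext fun G hG => ?_
  have h2 : 2 ≤ n := by omega
  have hp := offCoeff_mul_offCoeff (K := K) (i := i) ht hG
  have hp' := offCoeff_mul_offCoeff (K := K) (i := i + 1) ht hG
  have hd := diagCoeff_swap (K := K) ht (hG.content_ne_succ i)
  have hd' := diagCoeff_swap (K := K) ht (hG.content_ne_succ (i + 1))
  -- The three contents are pairwise different, the first and the last because labels on one
  -- diagonal differ by at least three.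
  have hm : (diagCoeff t (G i) (G (i + 1)) : K) * diagCoeff t (G (i + 1)) (G (i + 1 + 1)) +
        diagCoeff t (G i) (G (i + 1 + 1)) *
          ((t : K) - (t : K)⁻¹ - diagCoeff t (G i) (G (i + 1))) =
      diagCoeff t (G (i + 1)) (G (i + 1 + 1)) * diagCoeff t (G i) (G (i + 1 + 1)) := by
    have h := contentCoeff_mul (K := K) ht (hG.content_ne_succ i) (hG.content_ne_succ (i + 1))
      (by rw [sub_add_sub_cancel]; exact hG.content_ne_add_two i)
    rw [sub_add_sub_cancel] at h
    exact h
  have hb : ((G.swap n i).swap n (i + 1)).swap n i =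
      ((G.swap n (i + 1)).swap n i).swap n (i + 1) := by
    ext1 j
    simp only [swap_apply]
    rw [perSwap_braid h3]
  simp only [Module.End.mul_apply, stripT_basis, map_smul, map_add, swap_apply, perSwap_self h2,
    perSwap_succ h2, swap_swap h2, perSwap_add_two h3, perSwap_succ_self h3, hb, hd, hd']
  match_scalars
  · linear_combination (diagCoeff t (G i) (G (i + 1 + 1)) : K) * (hp - hp') +
      ((diagCoeff t (G i) (G (i + 1)) : K) - diagCoeff t (G (i + 1)) (G (i + 1 + 1))) * hm
  · linear_combination (offCoeff t (G i) (G (i + 1)) : K) * hm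
  · linear_combination -(offCoeff t (G (i + 1)) (G (i + 1 + 1)) : K) * hm
  all_goals ring

end Relations

theorem stripT_comm (hn : 2 ≤ n) {i j : ℤ} (h0 : ¬ (n : ℤ) ∣ j - i)
    (h1 : ¬ (n : ℤ) ∣ j - (i + 1)) (h2 : ¬ (n : ℤ) ∣ i - (j + 1)) :
    stripT n k t i * stripT n k t j = stripT n k t j * stripT (K := K) (N := N) n k t i := by
  refine stripSpace_hom_ext fun G hG => ?_
  obtain ⟨e1, e2, e3, e4⟩ := perSwap_of_far h0 h1 h2
  have hb : (G.swap n i).swap n j = (G.swap n j).swap n i := by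
    ext1 x
    exact congrArg G (perSwap_comm hn h0 h1 h2 x)
  simp only [Module.End.mul_apply, stripT_basis, map_smul, map_add, swap_apply, e1, e2, e3, e4, hb]
  match_scalars <;> ring

theorem stripT_stripY_comm {i j : ℤ} (h0 : ¬ (n : ℤ) ∣ j - i) (h1 : ¬ (n : ℤ) ∣ j - (i + 1)) :
    stripT n k t i * stripY n k t j = stripY n k t j * stripT (K := K) (N := N) n k t i := by
  refine stripSpace_hom_ext fun G hG => ?_
  simp only [Module.End.mul_apply, stripT_basis, stripY_basis, map_smul, map_add, content_swap,
    perSwap_of_not_dvd h0 h1]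
  match_scalars <;> ring

/-- A whole period moves both boxes by the same number of columns, which changes neither their
content difference nor their comparability. -/
theorem stripT_congr {i j : ℤ} (h : (n : ℤ) ∣ i - j) :
    stripT (K := K) (N := N) n k t i = stripT n k t j := by
  refine stripSpace_hom_ext fun G hG => ?_
  obtain ⟨c, hc⟩ := h
  obtain rfl : i = j + n * c := by linarith
  have e1 : j + n * c + 1 = j + 1 + n * c := by ring
  have hoff : ∀ a b : Fin N × ℤ, (offCoeff t (a.1, a.2 + k * c) (b.1, b.2 + k * c) : K) =
      offCoeff t a b := by
    intro a b
    have : Comparable (a.1, a.2 + k * c) (b.1, b.2 + k * c) ↔ Comparable a b := by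
      simp [Comparable, Prod.le_def]
    have hd : (diagCoeff t (a.1, a.2 + k * c) (b.1, b.2 + k * c) : K) = diagCoeff t a b := by
      simp only [diagCoeff, boxContent]
      ring_nf
    rw [offCoeff, offCoeff, hd]
    by_cases hc : Comparable a b
    · rw [if_pos (this.2 hc), if_pos hc]
    · rw [if_neg fun h => hc (this.1 h), if_neg hc]
  rw [stripT_basis, stripT_basis, e1, hG.1.apply_add_mul, hG.1.apply_add_mul, hoff,
    swap_congr (n := n) (i := j + n * c) (j := j) (by simp)]
  congr 2
  simp only [diagCoeff, boxContent]
  ring_nf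

/-- One period multiplies weights by `t^(2k)`, which becomes the factor `q⁻¹` in the relations for
`T_0` and `π`. -/
theorem stripY_add (j c : ℤ) :
    stripY n k t (j + n * c) = ((t : K) ^ (2 * (k * c))) • stripY (N := N) n k t j := by
  refine stripSpace_hom_ext fun G hG => ?_
  rw [LinearMap.smul_apply, stripY_basis, stripY_basis, hG.1.content_add_mul, smul_smul, mul_add,
    zpow_add₀ t.ne_zero, mul_comm]

theorem stripY_comm (i j : ℤ) :
    stripY n k t i * stripY n k t j = stripY n k t j * stripY (K := K) (N := N) n k t i := by
  refine stripSpace_hom_ext fun G hG => ?_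
  simp only [Module.End.mul_apply, stripY_basis, map_smul]
  rw [smul_comm]

theorem stripShift_stripT (d i : ℤ) : stripShift K N n k d * stripT n k t i =
    stripT n k t (i + d) * stripShift K N n k d := by
  refine stripSpace_hom_ext fun G hG => ?_
  have e1 : i + d + 1 - d = i + 1 := by ring
  simp only [Module.End.mul_apply, stripT_basis, stripShift_basis, map_smul, map_add, shift_apply,
    add_sub_cancel_right, e1, swap_shift]

theorem stripShift_stripY (d j : ℤ) : stripShift K N n k d * stripY n k t j =
    stripY n k t (j + d) * stripShift K N n k d := by
  refine stripSpace_hom_ext fun G hG => ?_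
  simp only [Module.End.mul_apply, stripY_basis, stripShift_basis, map_smul, content_shift,
    add_sub_cancel_right]

theorem stripShift_mul (d e : ℤ) :
    stripShift K N n k d * stripShift K N n k e = stripShift K N n k (d + e) := by
  refine stripSpace_hom_ext fun G hG => ?_
  simp only [Module.End.mul_apply, stripShift_basis, shift_shift, add_comm]

theorem stripShift_zero : stripShift K N n k 0 = 1 := by
  refine stripSpace_hom_ext fun G hG => ?_
  simp only [Module.End.one_apply, stripShift_basis, shift_zero]

end StripRep

/-! ### The double affine Hecke algebra, with generators indexed by the integers -/

namespace DAHA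

section ZLabel

variable {n : ℕ} [NeZero n]

/-- The label in `{0, …, n - 1}` that corresponds to an index of the generators. -/
def zlabel (i : ZMod n) : ℤ := ((i - 1).val : ℤ)

omit [NeZero n] in
theorem zlabel_nonneg (i : ZMod n) : 0 ≤ zlabel i := Int.natCast_nonneg _

theorem zlabel_lt (i : ZMod n) : zlabel i < n := by
  unfold zlabel
  exact_mod_cast ZMod.val_lt _

theorem cast_zlabel (i : ZMod n) : ((zlabel i + 1 : ℤ) : ZMod n) = i := by
  simp [zlabel]

theorem dvd_zlabel_sub_iff (i : ZMod n) (a : ℤ) :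
    (n : ℤ) ∣ zlabel i - a ↔ i = ((a + 1 : ℤ) : ZMod n) := by
  rw [← sub_eq_zero, ← ZMod.intCast_zmod_eq_zero_iff_dvd]
  conv_rhs => rw [← cast_zlabel i]
  push_cast
  rw [add_sub_add_right_eq_sub]

theorem zlabel_intCast {a : ℤ} (h0 : 0 ≤ a) (h1 : a < n) :
    zlabel ((a + 1 : ℤ) : ZMod n) = a := by
  obtain ⟨c, hc⟩ := (dvd_zlabel_sub_iff ((a + 1 : ℤ) : ZMod n) a).2 rfl
  have := zlabel_nonneg ((a + 1 : ℤ) : ZMod n)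
  have := zlabel_lt ((a + 1 : ℤ) : ZMod n)
  have hc0 : c = 0 := by
    by_contra h
    rcases lt_or_gt_of_ne h with h | h <;> nlinarith
  rw [hc0] at hc
  omega

theorem zlabel_zero : zlabel (0 : ZMod n) = n - 1 := by
  have := zlabel_intCast (n := n) (a := n - 1) (by have := NeZero.pos n; omega) (by omega)
  simpa using this

theorem zlabel_one : zlabel (1 : ZMod n) = 0 := by
  have := zlabel_intCast (n := n) (a := 0) le_rfl (by exact_mod_cast NeZero.pos n)
  simpa using this

theorem zlabel_add_one {i : ZMod n} (hi : i ≠ 0) : zlabel (i + 1) = zlabel i + 1 := by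
  have h : zlabel i + 1 ≠ n := fun h => hi (by rw [← cast_zlabel i, h]; simp)
  have h1 := zlabel_lt i
  have h0 := zlabel_nonneg i
  have := zlabel_intCast (n := n) (a := zlabel i + 1) (by omega) (by omega)
  rwa [Int.cast_add, cast_zlabel, Int.cast_one] at this

end ZLabel

variable {K : Type*} [Field K] (n : ℕ) (q t : Kˣ)

/-- The generator that exchanges the labels `i` and `i + 1`. -/
def intT (i : ℤ) : Alg n q t := of n q t (Gen.T ((i + 1 : ℤ) : ZMod n))

/-- The generator that belongs to the label `j`, extended to all integers `j` by
`Y_{j + n} = q⁻¹ Y_j`. -/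
noncomputable def intY (j : ℤ) : Alg n q t :=
  ((q : K) ^ (-(j / (n : ℤ)))) • of n q t (Gen.Y ((j + 1 : ℤ) : ZMod n))

/-- The inverse of `intY`. -/
noncomputable def intYInv (j : ℤ) : Alg n q t :=
  ((q : K) ^ (j / (n : ℤ))) • of n q t (Gen.YInv ((j + 1 : ℤ) : ZMod n))

theorem pi_mul_piInv : of n q t Gen.pi * of n q t Gen.piInv = 1 := by
  have h := RingQuot.mkAlgHom_rel K (Rel.pi_mul_piInv (n := n) (q := q) (t := t))
  rw [map_mul, map_one] at h
  exact h

theorem piInv_mul_pi : of n q t Gen.piInv * of n q t Gen.pi = 1 := by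
  have h := RingQuot.mkAlgHom_rel K (Rel.piInv_mul_pi (n := n) (q := q) (t := t))
  rw [map_mul, map_one] at h
  exact h

/-- The invertible generator `π`. -/
def piUnit : (Alg n q t)ˣ :=
  ⟨of n q t Gen.pi, of n q t Gen.piInv, pi_mul_piInv n q t, piInv_mul_pi n q t⟩

theorem Y_mul_YInv (i : ZMod n) : of n q t (Gen.Y i) * of n q t (Gen.YInv i) = 1 := by
  have h := RingQuot.mkAlgHom_rel K (Rel.Y_mul_YInv (n := n) (q := q) (t := t) i)
  rw [map_mul, map_one] at h
  exact h

theorem YInv_mul_Y (i : ZMod n) : of n q t (Gen.YInv i) * of n q t (Gen.Y i) = 1 := by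
  have h := RingQuot.mkAlgHom_rel K (Rel.YInv_mul_Y (n := n) (q := q) (t := t) i)
  rw [map_mul, map_one] at h
  exact h

theorem mul_self_of_hecke {A : Type*} [Ring A] [Algebra K A] {t : Kˣ} {x : A}
    (h : (x - algebraMap K A t) * (x + algebraMap K A (t : K)⁻¹) = 0) :
    x * x = ((t : K) - (t : K)⁻¹) • x + 1 := by
  rw [mul_add, sub_mul, sub_mul, ← map_mul, mul_inv_cancel₀ t.ne_zero, map_one,
    ← Algebra.commutes, ← Algebra.smul_def, ← Algebra.smul_def] at h
  rw [sub_smul]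
  rw [← sub_eq_zero, ← h]
  abel

theorem T_mul_T (i : ZMod n) : of n q t (Gen.T i) * of n q t (Gen.T i) =
    ((t : K) - (t : K)⁻¹) • of n q t (Gen.T i) + 1 := by
  have h := RingQuot.mkAlgHom_rel K (Rel.hecke (n := n) (q := q) (t := t) i)
  simp only [map_mul, map_sub, map_add, map_zero, AlgHom.commutes] at h
  exact mul_self_of_hecke h

theorem intT_mul_intT (i : ℤ) : intT n q t i * intT n q t i =
    ((t : K) - (t : K)⁻¹) • intT n q t i + 1 := T_mul_T n q t _

theorem intT_congr {n : ℕ} {q t : Kˣ} {i j : ℤ} (h : (n : ℤ) ∣ i - j) :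
    intT n q t i = intT n q t j := by
  unfold intT
  congr 2
  rw [← sub_eq_zero, ← Int.cast_sub, ZMod.intCast_zmod_eq_zero_iff_dvd]
  simpa using h

theorem intY_mul_intYInv (j : ℤ) : intY n q t j * intYInv n q t j = 1 := by
  rw [intY, intYInv, smul_mul_smul_comm, Y_mul_YInv, ← zpow_add₀ q.ne_zero, neg_add_cancel,
    zpow_zero, one_smul]

theorem intYInv_mul_intY (j : ℤ) : intYInv n q t j * intY n q t j = 1 := by
  rw [intY, intYInv, smul_mul_smul_comm, YInv_mul_Y, ← zpow_add₀ q.ne_zero, add_neg_cancel,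
    zpow_zero, one_smul]

theorem intY_comm (i j : ℤ) : intY n q t i * intY n q t j = intY n q t j * intY n q t i := by
  have h := RingQuot.mkAlgHom_rel K (Rel.Y_comm (n := n) (q := q) (t := t)
    ((i + 1 : ℤ) : ZMod n) ((j + 1 : ℤ) : ZMod n))
  rw [map_mul, map_mul] at h
  change of n q t _ * of n q t _ = of n q t _ * of n q t _ at h
  rw [intY, intY, smul_mul_smul_comm, smul_mul_smul_comm, h, mul_comm]

theorem intT_braid {n : ℕ} {q t : Kˣ} (hn : n ≠ 2) (i : ℤ) :
    intT n q t i * intT n q t (i + 1) * intT n q t i =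
      intT n q t (i + 1) * intT n q t i * intT n q t (i + 1) := by
  have h := RingQuot.mkAlgHom_rel K (Rel.braid (q := q) (t := t) hn ((i + 1 : ℤ) : ZMod n))
  simp only [map_mul] at h
  simp only [intT, Int.cast_add, Int.cast_one] at h ⊢
  exact h

theorem intT_comm {n : ℕ} {q t : Kˣ} (hn : n ≠ 2) {i j : ℤ} (h1 : ¬ (n : ℤ) ∣ j - (i + 1))
    (h2 : ¬ (n : ℤ) ∣ i - (j + 1)) :
    intT n q t i * intT n q t j = intT n q t j * intT n q t i := by
  have h := RingQuot.mkAlgHom_rel K (Rel.T_comm (q := q) (t := t) hn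
    ((i + 1 : ℤ) : ZMod n) ((j + 1 : ℤ) : ZMod n) (fun h => h1 ?_) fun h => h2 ?_)
  · rw [map_mul, map_mul] at h
    exact h
  · rw [← ZMod.intCast_zmod_eq_zero_iff_dvd]
    push_cast at h ⊢
    linear_combination h
  · rw [← ZMod.intCast_zmod_eq_zero_iff_dvd]
    push_cast at h ⊢
    linear_combination -h

theorem intT_intY_comm {n : ℕ} {q t : Kˣ} {i j : ℤ} (h0 : ¬ (n : ℤ) ∣ j - i)
    (h1 : ¬ (n : ℤ) ∣ j - (i + 1)) :
    intT n q t i * intY n q t j = intY n q t j * intT n q t i := by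
  have h := RingQuot.mkAlgHom_rel K (Rel.T_Y_comm (q := q) (t := t)
    ((i + 1 : ℤ) : ZMod n) ((j + 1 : ℤ) : ZMod n) (fun h => h0 ?_) fun h => h1 ?_)
  · rw [map_mul, map_mul] at h
    rw [intY, mul_smul_comm, smul_mul_assoc]
    exact congrArg _ h
  · rw [← ZMod.intCast_zmod_eq_zero_iff_dvd]
    push_cast at h ⊢
    linear_combination h
  · rw [← ZMod.intCast_zmod_eq_zero_iff_dvd]
    push_cast at h ⊢
    linear_combination h

theorem pi_mul_intT (i : ℤ) : of n q t Gen.pi * intT n q t i =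
    intT n q t (i + 1) * of n q t Gen.pi := by
  have h := RingQuot.mkAlgHom_rel K (Rel.pi_T (q := q) (t := t) ((i + 1 : ℤ) : ZMod n))
  rw [map_mul, map_mul] at h
  change of n q t _ * of n q t _ * of n q t _ = of n q t _ at h
  rw [intT, intT, Int.cast_add (i + 1), Int.cast_one, ← h, mul_assoc _ (of n q t Gen.piInv),
    piInv_mul_pi, mul_one]

section

variable [NeZero n]

theorem add_one_ediv_of_dvd {n : ℕ} [NeZero n] {j : ℤ} (h : (n : ℤ) ∣ j + 1) :
    (j + 1) / (n : ℤ) = j / n + 1 := by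
  have hn : (0 : ℤ) < n := by exact_mod_cast NeZero.pos n
  obtain ⟨c, hc⟩ := h
  have : j / (n : ℤ) = c - 1 := by
    obtain rfl : j = (n - 1) + n * (c - 1) := by linarith
    rw [Int.add_mul_ediv_left _ _ hn.ne', Int.ediv_eq_zero_of_lt (by omega) (by omega), zero_add]
  rw [hc, this, Int.mul_ediv_cancel_left _ hn.ne']
  ring

theorem add_one_ediv_of_not_dvd {n : ℕ} [NeZero n] {j : ℤ} (h : ¬ (n : ℤ) ∣ j + 1) :
    (j + 1) / (n : ℤ) = j / n := by
  have hn : (0 : ℤ) < n := by exact_mod_cast NeZero.pos n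
  refine Int.ediv_eq_iff_of_pos hn |>.2 ?_
  have h1 := Int.emod_add_mul_ediv j n
  have h2 := Int.emod_nonneg j hn.ne'
  have h3 := Int.emod_lt_of_pos j hn
  have h4 : j % n + 1 ≠ n := fun h4 => h ⟨j / n + 1, by linarith⟩
  constructor
  · linarith
  · have h5 : j % n + 1 < n := by omega
    linarith

/-- The quotient `i / n` jumps exactly when `i + 1` is a multiple of `n`, and the jump supplies the
`q⁻¹` of `T_0 Y_n T_0 = q⁻¹ Y_1`. With integer indices this relation is no longer exceptional. -/
theorem intT_intY_intT (i : ℤ) : intT n q t i * intY n q t i * intT n q t i =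
    intY n q t (i + 1) := by
  rw [intY, intY, mul_smul_comm, smul_mul_assoc]
  by_cases hi : (n : ℤ) ∣ i + 1
  · have h := RingQuot.mkAlgHom_rel K (Rel.T_Y_T_zero (n := n) (q := q) (t := t))
    have h0 : ((i + 1 : ℤ) : ZMod n) = 0 := (ZMod.intCast_zmod_eq_zero_iff_dvd _ _).2 hi
    rw [map_mul, map_mul, map_mul, AlgHom.commutes, ← Algebra.smul_def] at h
    rw [intT, add_one_ediv_of_dvd hi, Int.cast_add (i + 1), h0, zero_add, Int.cast_one, neg_add,
      zpow_add₀ q.ne_zero, zpow_neg_one, mul_smul]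
    exact congrArg _ h
  · have h0 : ((i + 1 : ℤ) : ZMod n) ≠ 0 := fun h => hi ((ZMod.intCast_zmod_eq_zero_iff_dvd _ _).1 h)
    have h := RingQuot.mkAlgHom_rel K (Rel.T_Y_T (q := q) (t := t) ((i + 1 : ℤ) : ZMod n) h0)
    rw [map_mul, map_mul] at h
    rw [intT, add_one_ediv_of_not_dvd hi, Int.cast_add (i + 1), Int.cast_one]
    exact congrArg _ h

theorem pi_mul_intY (j : ℤ) : of n q t Gen.pi * intY n q t j =
    intY n q t (j + 1) * of n q t Gen.pi := by
  rw [intY, intY, mul_smul_comm, smul_mul_assoc]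
  by_cases hi : (n : ℤ) ∣ j + 1
  · have h := RingQuot.mkAlgHom_rel K (Rel.pi_Y_zero (n := n) (q := q) (t := t))
    have h0 : ((j + 1 : ℤ) : ZMod n) = 0 := (ZMod.intCast_zmod_eq_zero_iff_dvd _ _).2 hi
    rw [map_mul, map_mul, map_mul, AlgHom.commutes, ← Algebra.smul_def] at h
    change of n q t _ * of n q t _ * of n q t _ = (q : K)⁻¹ • of n q t _ at h
    rw [add_one_ediv_of_dvd hi, Int.cast_add (j + 1), h0, zero_add, Int.cast_one, neg_add,
      zpow_add₀ q.ne_zero, zpow_neg_one, mul_smul, ← smul_mul_assoc (q : K)⁻¹, ← h,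
      mul_assoc _ (of n q t Gen.piInv), piInv_mul_pi, mul_one]
  · have h0 : ((j + 1 : ℤ) : ZMod n) ≠ 0 := fun h => hi ((ZMod.intCast_zmod_eq_zero_iff_dvd _ _).1 h)
    have h := RingQuot.mkAlgHom_rel K (Rel.pi_Y (q := q) (t := t) ((j + 1 : ℤ) : ZMod n) h0)
    rw [map_mul, map_mul] at h
    change of n q t _ * of n q t _ * of n q t _ = of n q t _ at h
    rw [add_one_ediv_of_not_dvd hi, Int.cast_add (j + 1), Int.cast_one, ← h,
      mul_assoc _ (of n q t Gen.piInv), piInv_mul_pi, mul_one]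

end

theorem piUnit_zpow_mul_intT (d i : ℤ) : ((piUnit n q t ^ d : (Alg n q t)ˣ) : Alg n q t) *
    intT n q t i = intT n q t (i + d) * ((piUnit n q t ^ d : (Alg n q t)ˣ) : Alg n q t) := by
  induction d generalizing i with
  | zero => simp
  | succ d ih =>
    rw [zpow_add_one, Units.val_mul, mul_assoc]
    change _ * (of n q t Gen.pi * _) = _
    rw [pi_mul_intT, ← mul_assoc, ih, mul_assoc, add_right_comm, add_assoc]
    rfl
  | pred d ih =>
    have h : ((piUnit n q t)⁻¹ : (Alg n q t)ˣ) * intT n q t i =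
        intT n q t (i - 1) * ((piUnit n q t)⁻¹ : (Alg n q t)ˣ) := by
      rw [Units.inv_mul_eq_iff_eq_mul, ← mul_assoc, Units.eq_mul_inv_iff_mul_eq]
      have := pi_mul_intT n q t (i - 1)
      rw [sub_add_cancel] at this
      exact this.symm
    rw [zpow_sub_one, Units.val_mul, mul_assoc, h, ← mul_assoc, ih, mul_assoc]
    congr 2
    ring

theorem piUnit_zpow_mul_intY [NeZero n] (d j : ℤ) :
    ((piUnit n q t ^ d : (Alg n q t)ˣ) : Alg n q t) *
    intY n q t j = intY n q t (j + d) * ((piUnit n q t ^ d : (Alg n q t)ˣ) : Alg n q t) := by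
  induction d generalizing j with
  | zero => simp
  | succ d ih =>
    rw [zpow_add_one, Units.val_mul, mul_assoc]
    change _ * (of n q t Gen.pi * _) = _
    rw [pi_mul_intY, ← mul_assoc, ih, mul_assoc, add_right_comm, add_assoc]
    rfl
  | pred d ih =>
    have h : ((piUnit n q t)⁻¹ : (Alg n q t)ˣ) * intY n q t j =
        intY n q t (j - 1) * ((piUnit n q t)⁻¹ : (Alg n q t)ˣ) := by
      rw [Units.inv_mul_eq_iff_eq_mul, ← mul_assoc, Units.eq_mul_inv_iff_mul_eq]
      have := pi_mul_intY n q t (j - 1)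
      rw [sub_add_cancel] at this
      exact this.symm
    rw [zpow_sub_one, Units.val_mul, mul_assoc, h, ← mul_assoc, ih, mul_assoc]
    congr 2
    ring

end DAHA

/-! ### The action of the double affine Hecke algebra on the strip -/

theorem hecke_of_mul_self {K A : Type*} [Field K] [Ring A] [Algebra K A] {t : Kˣ} {x : A}
    (h : x * x = ((t : K) - (t : K)⁻¹) • x + 1) :
    (x - algebraMap K A t) * (x + algebraMap K A (t : K)⁻¹) = 0 := by
  rw [mul_add, sub_mul, sub_mul, ← map_mul, mul_inv_cancel₀ t.ne_zero, map_one,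
    ← Algebra.commutes, ← Algebra.smul_def, ← Algebra.smul_def, h, sub_smul]
  abel

section StripAction

open DAHA

variable {K : Type*} [Field K] {n : ℕ} (N k : ℕ) {q t : Kˣ}

/-- The operator that divides a filling by the weight of the label `j`. -/
noncomputable def stripYInv (n : ℕ) (t : Kˣ) (j : ℤ) : Module.End K (StripSpace K N n k) :=
  Finsupp.linearCombination K fun G : {G : StripFilling N // G.IsStandard n k} =>
    ((t : K) ^ (-(2 * G.1.content j))) • stripBasis K n k G.1

variable {N k} in
theorem stripYInv_basis (j : ℤ) {G : StripFilling N} (h : G.IsStandard n k) :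
    stripYInv N k n t j (stripBasis K n k G) =
      ((t : K) ^ (-(2 * G.content j))) • stripBasis K n k G := by
  rw [stripBasis_of_isStandard h, stripYInv, Finsupp.linearCombination_single, one_smul,
    stripBasis_of_isStandard h]

/-- The operators on the strip by which the generators of the double affine Hecke algebra act. -/
noncomputable def stripGen (n : ℕ) [NeZero n] (t : Kˣ) : Gen n → Module.End K (StripSpace K N n k)
  | Gen.T i => stripT n k t (zlabel i)
  | Gen.pi => stripShift K N n k 1
  | Gen.piInv => stripShift K N n k (-1)
  | Gen.Y i => stripY n k t (zlabel i)
  | Gen.YInv i => stripYInv N k n t (zlabel i)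

variable [NeZero n]

theorem stripT_zlabel (i : ℤ) :
    stripT n k t (zlabel ((i + 1 : ℤ) : ZMod n)) = stripT (N := N) n k t i :=
  stripT_congr ((dvd_zlabel_sub_iff _ _).2 rfl)

theorem stripT_zlabel_add_one (i : ZMod n) :
    stripT n k t (zlabel (i + 1)) = stripT (N := N) n k t (zlabel i + 1) := by
  have h := stripT_zlabel (n := n) (t := t) N k (zlabel i + 1)
  rwa [Int.cast_add, cast_zlabel, Int.cast_one] at h

theorem not_dvd_zlabel_sub {i j : ZMod n} (h : j ≠ i) :
    ¬ (n : ℤ) ∣ zlabel j - zlabel i := by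
  rwa [dvd_zlabel_sub_iff, cast_zlabel]

theorem not_dvd_zlabel_sub_add_one {i j : ZMod n} (h : j ≠ i + 1) :
    ¬ (n : ℤ) ∣ zlabel j - (zlabel i + 1) := by
  rwa [dvd_zlabel_sub_iff, Int.cast_add, cast_zlabel, Int.cast_one]

theorem stripGen_rel (ht : ∀ m : ℕ, 0 < m → t ^ m ≠ 1) (hq : q = t ^ (-(2 * (k : ℤ))))
    ⦃x y : FreeAlgebra K (Gen n)⦄ (h : Rel n q t x y) :
    FreeAlgebra.lift K (stripGen N k n t) x = FreeAlgebra.lift K (stripGen N k n t) y := by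
  have hn : 0 < n := NeZero.pos n
  have hq' : (q : K)⁻¹ = (t : K) ^ (2 * ((k : ℤ) * 1)) := by
    rw [hq, Units.val_zpow_eq_zpow_val, zpow_neg, inv_inv, mul_one]
  have hY1 : stripY n k t (zlabel (0 : ZMod n) + 1) =
      (q : K)⁻¹ • stripY (N := N) n k t (zlabel (1 : ZMod n)) := by
    rw [zlabel_zero, zlabel_one, hq', ← stripY_add 0 1 (n := n)]
    congr 1
    ring
  cases h with
  | pi_mul_piInv =>
    simp only [map_mul, map_one, FreeAlgebra.lift_ι_apply, stripGen, stripShift_mul]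
    exact stripShift_zero
  | piInv_mul_pi =>
    simp only [map_mul, map_one, FreeAlgebra.lift_ι_apply, stripGen, stripShift_mul]
    exact stripShift_zero
  | Y_mul_YInv i =>
    simp only [map_mul, map_one, FreeAlgebra.lift_ι_apply, stripGen]
    refine stripSpace_hom_ext fun G hG => ?_
    rw [Module.End.mul_apply, stripYInv_basis _ hG, map_smul, stripY_basis, smul_smul,
      ← zpow_add₀ t.ne_zero, neg_add_cancel, zpow_zero, one_smul, Module.End.one_apply]
  | YInv_mul_Y i =>
    simp only [map_mul, map_one, FreeAlgebra.lift_ι_apply, stripGen]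
    refine stripSpace_hom_ext fun G hG => ?_
    rw [Module.End.mul_apply, stripY_basis, map_smul, stripYInv_basis _ hG, smul_smul,
      ← zpow_add₀ t.ne_zero, add_neg_cancel, zpow_zero, one_smul, Module.End.one_apply]
  | Y_comm i j =>
    simp only [map_mul, FreeAlgebra.lift_ι_apply, stripGen]
    exact stripY_comm _ _
  | hecke i =>
    simp only [map_mul, map_add, map_sub, map_zero, AlgHom.commutes, FreeAlgebra.lift_ι_apply,
      stripGen]
    exact hecke_of_mul_self (A := Module.End K (StripSpace K N n k)) (stripT_mul_stripT ht hn _)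
  | braid h2 i =>
    simp only [map_mul, FreeAlgebra.lift_ι_apply, stripGen, stripT_zlabel_add_one]
    by_cases h3 : 3 ≤ n
    · exact stripT_braid ht h3 _
    -- The braid relation is imposed for `n = 1` as well, where all indices coincide and it is
    -- trivial.
    · obtain rfl : n = 1 := by omega
      rw [stripT_congr (i := zlabel i + 1) (j := zlabel i) (by simp)]
  | T_comm h2 i j h h' =>
    simp only [map_mul, FreeAlgebra.lift_ι_apply, stripGen]
    by_cases hij : j = i
    · rw [hij]
    · by_cases h1 : n = 1
      · subst h1
        exact (hij (Subsingleton.elim _ _)).elim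
      · refine stripT_comm (by omega) (not_dvd_zlabel_sub hij) (not_dvd_zlabel_sub_add_one h)
          (not_dvd_zlabel_sub_add_one fun h => h' ?_)
        rw [h, add_sub_cancel_right]
  | pi_T i =>
    simp only [map_mul, FreeAlgebra.lift_ι_apply, stripGen, stripT_zlabel_add_one]
    rw [stripShift_stripT, mul_assoc, stripShift_mul, add_neg_cancel, stripShift_zero, mul_one]
  | T_Y_T i hi =>
    simp only [map_mul, FreeAlgebra.lift_ι_apply, stripGen, zlabel_add_one hi]
    exact stripT_stripY_stripT ht hn _
  | T_Y_T_zero =>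
    simp only [map_mul, FreeAlgebra.lift_ι_apply, stripGen, AlgHom.commutes]
    rw [stripT_stripY_stripT ht hn, hY1, Algebra.smul_def]
  | T_Y_comm i j h h' =>
    simp only [map_mul, FreeAlgebra.lift_ι_apply, stripGen]
    exact stripT_stripY_comm (not_dvd_zlabel_sub h) (not_dvd_zlabel_sub_add_one h')
  | pi_Y i hi =>
    simp only [map_mul, FreeAlgebra.lift_ι_apply, stripGen, zlabel_add_one hi]
    rw [stripShift_stripY, mul_assoc, stripShift_mul, add_neg_cancel, stripShift_zero, mul_one]
  | pi_Y_zero =>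
    simp only [map_mul, FreeAlgebra.lift_ι_apply, stripGen, AlgHom.commutes]
    rw [stripShift_stripY, mul_assoc, stripShift_mul, add_neg_cancel, stripShift_zero, mul_one,
      hY1, Algebra.smul_def]

/-- The action of the double affine Hecke algebra on the strip. -/
noncomputable def stripAction (ht : ∀ m : ℕ, 0 < m → t ^ m ≠ 1)
    (hq : q = t ^ (-(2 * (k : ℤ)))) : Alg n q t →ₐ[K] Module.End K (StripSpace K N n k) :=
  RingQuot.liftAlgHom K ⟨FreeAlgebra.lift K (stripGen N k n t), stripGen_rel N k ht hq⟩

variable (ht : ∀ m : ℕ, 0 < m → t ^ m ≠ 1) (hq : q = t ^ (-(2 * (k : ℤ))))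

theorem stripAction_of (g : Gen n) :
    stripAction N k ht hq (of n q t g) = stripGen N k n t g := by
  rw [stripAction, of, RingQuot.liftAlgHom_mkAlgHom_apply, FreeAlgebra.lift_ι_apply]

end StripAction

/-! ### Rectangular tableaux as fillings of the strip -/

section StripExt

variable {N k : ℕ} [NeZero N] [NeZero k]

/-- The boxes of the strip, divided into rectangles with `k` columns. -/
def stripBoxEquiv (N k : ℕ) [NeZero k] : ℤ × (Fin N × Fin k) ≃ Fin N × ℤ where
  toFun p := (p.2.1, (Int.divModEquiv k).symm (p.1, p.2.2))
  invFun p := ((Int.divModEquiv k p.2).1, p.1, (Int.divModEquiv k p.2).2)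
  left_inv p := by simp only [Equiv.apply_symm_apply]
  right_inv p := by simp only [Prod.mk.eta, Equiv.symm_apply_apply]

/-- The periodic extension of a filling of the rectangle to the strip. -/
def stripExt (R : Fin N × Fin k ≃ Fin (N * k)) : StripFilling N :=
  (Int.divModEquiv (N * k)).trans
    (((Equiv.refl ℤ).prodCongr R.symm).trans (stripBoxEquiv N k))

variable (R : Fin N × Fin k ≃ Fin (N * k))

theorem stripExt_apply (c : ℤ) (l : Fin (N * k)) :
    stripExt R (c * (N * k : ℕ) + (l : ℕ)) =
      ((R.symm l).1, c * k + ((R.symm l).2 : ℕ)) := by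
  have h : Int.divModEquiv (N * k) (c * (N * k : ℕ) + (l : ℕ)) = (c, l) := by
    rw [← Int.divModEquiv_symm_apply (N * k) (c, l), Equiv.apply_symm_apply]
  simp only [stripExt, Equiv.trans_apply, h, Equiv.prodCongr_apply, Prod.map,
    Equiv.refl_apply, stripBoxEquiv, Equiv.coe_fn_mk, Int.divModEquiv_symm_apply]

theorem stripExt_apply_fin (l : Fin (N * k)) :
    stripExt R (l : ℕ) = ((R.symm l).1, (((R.symm l).2 : ℕ) : ℤ)) := by
  simpa using stripExt_apply R 0 l

omit [NeZero N] [NeZero k] in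
theorem exists_eq_mul_add (n : ℕ) [NeZero n] (j : ℤ) :
    ∃ (c : ℤ) (l : Fin n), j = c * n + (l : ℕ) :=
  ⟨_, _, ((Int.divModEquiv n).symm_apply_apply j).symm⟩

theorem stripExt_isPeriodic : (stripExt R).IsPeriodic (N * k) k := by
  intro j
  obtain ⟨c, l, rfl⟩ := exists_eq_mul_add (N * k) j
  rw [show c * (N * k : ℕ) + (l : ℕ) + (N * k : ℕ) = (c + 1) * (N * k : ℕ) + (l : ℕ) by ring,
    stripExt_apply, stripExt_apply]
  ext
  · rfl
  · simp only
    ring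

theorem stripExt_block (j : ℤ) : (stripExt R j).2 / (k : ℤ) = j / ((N * k : ℕ) : ℤ) := by
  obtain ⟨c, l, rfl⟩ := exists_eq_mul_add (N * k) j
  have hk : (k : ℤ) ≠ 0 := by exact_mod_cast NeZero.ne k
  have hn : ((N * k : ℕ) : ℤ) ≠ 0 := by exact_mod_cast NeZero.ne (N * k)
  rw [stripExt_apply, add_comm, Int.add_mul_ediv_right _ _ hk, add_comm (c * _),
    Int.add_mul_ediv_right _ _ hn, Int.ediv_eq_zero_of_lt, Int.ediv_eq_zero_of_lt]
  all_goals omega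

theorem stripExt_isStandard {R : Fin N × Fin k ≃ Fin (N * k)} (hR : IsStandardFilling R) :
    (stripExt R).IsStandard (N * k) k := by
  refine ⟨stripExt_isPeriodic R, fun i j hij => ?_⟩
  have hk : (0 : ℤ) < k := by exact_mod_cast NeZero.pos k
  have hn : (0 : ℤ) < (N * k : ℕ) := by exact_mod_cast NeZero.pos (N * k)
  -- Rectangle number `c` contains exactly the labels from `cn` to `cn + n - 1`, so labels in
  -- different rectangles are ordered already, and inside one rectangle the tableau decides.
  have hb : i / ((N * k : ℕ) : ℤ) ≤ j / ((N * k : ℕ) : ℤ) := by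
    rw [← stripExt_block R, ← stripExt_block R]
    exact Int.ediv_le_ediv hk hij.2
  rcases hb.lt_or_eq with hb | hb
  · exact le_of_not_gt fun h => absurd (Int.ediv_le_ediv hn h.le) (not_le.2 hb)
  · obtain ⟨c, l, rfl⟩ := exists_eq_mul_add (N * k) i
    obtain ⟨d, m, rfl⟩ := exists_eq_mul_add (N * k) j
    have hl : ∀ l : Fin (N * k), ((l : ℕ) : ℤ) / ((N * k : ℕ) : ℤ) = 0 := fun l =>
      Int.ediv_eq_zero_of_lt (by omega) (by exact_mod_cast l.2)
    rw [add_comm (c * _), Int.add_mul_ediv_right _ _ hn.ne', add_comm (d * _),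
      Int.add_mul_ediv_right _ _ hn.ne', hl, hl, zero_add, zero_add] at hb
    subst hb
    rw [stripExt_apply, stripExt_apply, Prod.mk_le_mk, add_le_add_iff_left] at hij
    have h1 : R ((R.symm l).1, (R.symm l).2) ≤ R ((R.symm l).1, (R.symm m).2) :=
      (hR.1 _).monotone (by
        rw [Fin.le_def]
        exact_mod_cast hij.2)
    have h2 : R ((R.symm l).1, (R.symm m).2) ≤ R ((R.symm m).1, (R.symm m).2) :=
      (hR.2 _).monotone hij.1
    have h3 := h1.trans h2
    simp only [Prod.mk.eta, Equiv.apply_symm_apply, Fin.le_def] at h3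
    omega

theorem isStandardFilling_of_stripExt {R : Fin N × Fin k ≃ Fin (N * k)}
    (hR : (stripExt R).IsStandard (N * k) k) : IsStandardFilling R := by
  have key : ∀ x y : Fin N × Fin k, x ≤ y → R x ≤ R y := by
    intro x y hxy
    have := hR.2 (R x : ℕ) (R y : ℕ) (by
      rw [stripExt_apply_fin, stripExt_apply_fin, R.symm_apply_apply, R.symm_apply_apply,
        Prod.mk_le_mk]
      exact ⟨hxy.1, by exact_mod_cast hxy.2⟩)
    rw [Fin.le_def]
    exact_mod_cast this
  constructor
  · intro a
    refine Monotone.strictMono_of_injective (fun b b' h => key _ _ ⟨le_rfl, h⟩) fun b b' h => ?_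
    simpa using R.injective h
  · intro b
    refine Monotone.strictMono_of_injective (fun a a' h => key _ _ ⟨h, le_rfl⟩) fun a a' h => ?_
    simpa using R.injective h

theorem stripExt_swap {i : ℕ} (hi : i + 1 < N * k) :
    stripExt (R.trans (Equiv.swap ⟨i, Nat.lt_of_succ_lt hi⟩ ⟨i + 1, hi⟩)) =
      (stripExt R).swap (N * k) i := by
  have hn : 2 ≤ N * k := by omega
  ext1 j
  obtain ⟨c, l, rfl⟩ := exists_eq_mul_add (N * k) j
  have key : perSwap (N * k) i ((l : ℕ) : ℤ) =
      ((Equiv.swap (⟨i, Nat.lt_of_succ_lt hi⟩ : Fin (N * k)) ⟨i + 1, hi⟩ l : ℕ) : ℤ) := by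
    by_cases h1 : l = ⟨i, Nat.lt_of_succ_lt hi⟩
    · subst h1
      rw [Equiv.swap_apply_left, perSwap_self hn]
      simp
    · by_cases h2 : l = ⟨i + 1, hi⟩
      · subst h2
        rw [Equiv.swap_apply_right]
        push_cast
        rw [perSwap_succ hn]
      · rw [Equiv.swap_apply_of_ne_of_ne h1 h2]
        have hl := l.2
        have h1' : (l : ℕ) ≠ i := fun h => h1 (Fin.ext h)
        have h2' : (l : ℕ) ≠ i + 1 := fun h => h2 (Fin.ext h)
        refine perSwap_of_not_dvd ?_ ?_ <;>
        · intro hd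
          have := Int.eq_zero_of_abs_lt_dvd hd (by rw [abs_lt]; omega)
          omega
  have e : ∀ x : ℤ, c * (N * k : ℕ) + x = x + (N * k : ℕ) * c := fun x => by ring
  rw [stripExt_apply, StripFilling.swap_apply, e, perSwap_add_mul, key, ← e, stripExt_apply]
  simp

theorem stripExt_injective : Function.Injective (stripExt (N := N) (k := k)) := by
  intro R R' h
  have : R.symm = R'.symm := by
    ext1 l
    have := congrArg (fun G : StripFilling N => G (l : ℕ)) h
    simp only [stripExt_apply_fin, Prod.mk.injEq, Nat.cast_inj] at this
    exact Prod.ext this.1 (Fin.ext this.2)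
  simpa using congrArg Equiv.symm this

theorem stripExt_content (R : RectSYT N k) (l : Fin (N * k)) :
    (stripExt R.1).content (l : ℕ) = R.diag l := by
  rw [StripFilling.content, stripExt_apply_fin, RectSYT.diag]

/-- The smallest label sits in the corner box. This is why `Y_1`, which belongs to the label `0`,
acts as the identity. -/
theorem stripExt_content_zero {R : Fin N × Fin k ≃ Fin (N * k)} (hR : IsStandardFilling R) :
    (stripExt R).content 0 = 0 := by
  have h := (stripExt_isStandard hR).2 (R (0, 0) : ℕ) (0 : ℕ) (by
    have e : ((0 : ℕ) : ℤ) = (((0 : Fin (N * k)) : ℕ) : ℤ) := by simp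
    rw [e, stripExt_apply_fin, stripExt_apply_fin, R.symm_apply_apply, Prod.mk_le_mk]
    simp)
  have h0 : R (0, 0) = 0 := by
    ext
    simpa using h
  have h1 : R.symm 0 = (0, 0) := by rw [← h0, R.symm_apply_apply]
  have := stripExt_apply_fin R 0
  rw [h1] at this
  simp only [Fin.val_zero, Nat.cast_zero] at this
  simp [StripFilling.content, this]

variable (K : Type*) [Field K]

/-- The embedding of the rectangular representation into the representation on the strip. -/
noncomputable def rectEmb (N k : ℕ) [NeZero N] [NeZero k] :
    RectSpace K N k →ₗ[K] StripSpace K N (N * k) k :=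
  Finsupp.lmapDomain K K fun R => ⟨stripExt R.1, stripExt_isStandard R.2⟩

theorem rectEmb_injective : Function.Injective (rectEmb K N k) :=
  Finsupp.mapDomain_injective fun _ _ h => Subtype.ext
    (stripExt_injective (congrArg Subtype.val h))

theorem rectEmb_rectBasis : rectEmb K N k (rectBasis K R) = stripBasis K (N * k) k (stripExt R) := by
  by_cases h : IsStandardFilling R
  · rw [rectBasis, dif_pos h, stripBasis_of_isStandard (stripExt_isStandard h), rectEmb,
      Finsupp.lmapDomain_apply, Finsupp.mapDomain_single]
  · rw [rectBasis, dif_neg h, map_zero, stripBasis_of_not_isStandard fun h' =>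
      h (isStandardFilling_of_stripExt h')]

omit [NeZero N] [NeZero k] in
theorem rectSpace_hom_ext {V : Type*} [AddCommGroup V] [Module K V]
    {f g : RectSpace K N k →ₗ[K] V}
    (h : ∀ R : RectSYT N k, f (rectBasis K R.1) = g (rectBasis K R.1)) : f = g := by
  refine Finsupp.lhom_ext' fun R => LinearMap.ext_ring ?_
  have := h R
  rwa [rectBasis, dif_pos R.2] at this

variable {K} (t : Kˣ)

omit [NeZero N] [NeZero k] in
theorem seminormalT_rectBasis (R : RectSYT N k) (i j : Fin (N * k)) :
    seminormalT N k t i j (rectBasis K R.1) = seminormalCoeff t R i j • rectBasis K R.1 +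
      ((t : K)⁻¹ + seminormalCoeff t R i j) • rectBasis K (R.1.trans (Equiv.swap i j)) := by
  conv_lhs => rw [rectBasis, dif_pos R.2, seminormalT, Finsupp.linearCombination_single, one_smul]

theorem seminormalCoeff_eq (R : RectSYT N k) {i : ℕ} (hi : i + 1 < N * k) :
    (seminormalCoeff t R ⟨i, Nat.lt_of_succ_lt hi⟩ ⟨i + 1, hi⟩ : K) =
      diagCoeff t (stripExt R.1 (i : ℕ)) (stripExt R.1 ((i : ℕ) + 1)) := by
  have h1 := stripExt_content R ⟨i, Nat.lt_of_succ_lt hi⟩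
  have h2 := stripExt_content R ⟨i + 1, hi⟩
  rw [seminormalCoeff, ← h1, ← h2, diagCoeff, contentCoeff]
  simp [boxContent, StripFilling.content]

theorem stripT_rectEmb {i : ℕ} (hi : i + 1 < N * k) (v : RectSpace K N k) :
    stripT (N * k) k t i (rectEmb K N k v) =
      rectEmb K N k (seminormalT N k t ⟨i, Nat.lt_of_succ_lt hi⟩ ⟨i + 1, hi⟩ v) := by
  refine LinearMap.congr_fun (f := stripT (N * k) k t i ∘ₗ rectEmb K N k)
    (g := rectEmb K N k ∘ₗ seminormalT N k t ⟨i, Nat.lt_of_succ_lt hi⟩ ⟨i + 1, hi⟩)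
    (rectSpace_hom_ext K fun R => ?_) v
  simp only [LinearMap.comp_apply, rectEmb_rectBasis, seminormalT_rectBasis, map_add, map_smul]
  rw [stripT_basis_of_isStandard (by omega) _ (stripExt_isStandard R.2), seminormalCoeff_eq,
    stripExt_swap]

end StripExt

/-! ### The rectangular representation of the affine Hecke algebra -/

section Rectangular

open DAHA

variable {K : Type*} [Field K] {N k : ℕ} [NeZero N] [NeZero k] {q t : Kˣ}

theorem exists_succ_of_ne_zero {n : ℕ} [NeZero n] {i : ZMod n} (hi : i ≠ 0) :
    ∃ a : ℕ, a + 1 < n ∧ i = ((a + 1 : ℕ) : ZMod n) := by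
  obtain ⟨a, ha⟩ := Int.eq_ofNat_of_zero_le (zlabel_nonneg i)
  have h := zlabel_lt i
  have e := cast_zlabel i
  rw [ha] at h e
  have e' : i = ((a + 1 : ℕ) : ZMod n) := by
    rw [← e]
    push_cast
    rfl
  refine ⟨a, ?_, e'⟩
  by_contra h'
  obtain rfl : n = a + 1 := by omega
  exact hi (by rw [e', ZMod.natCast_self])

section

variable (ht : ∀ m : ℕ, 0 < m → t ^ m ≠ 1) (hq : q = t ^ (-(2 * (k : ℤ))))

theorem stripAction_T {i : ℕ} (hi : i + 1 < N * k) (v : RectSpace K N k) :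
    stripAction N k ht hq (of (N * k) q t (Gen.T ((i + 1 : ℕ) : ZMod (N * k))))
      (rectEmb K N k v) =
      rectEmb K N k (seminormalT N k t ⟨i, Nat.lt_of_succ_lt hi⟩ ⟨i + 1, hi⟩ v) := by
  rw [stripAction_of, ← stripT_rectEmb]
  have := stripT_zlabel (K := K) (n := N * k) (t := t) N k i
  push_cast at this ⊢
  rw [stripGen, this]

theorem stripAction_intY (j : ℤ) (G : StripFilling N) :
    stripAction N k ht hq (intY (N * k) q t j) (stripBasis K (N * k) k G) =
      ((t : K) ^ (2 * G.content j)) • stripBasis K (N * k) k G := by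
  have hn : (0 : ℤ) < (N * k : ℕ) := by exact_mod_cast NeZero.pos (N * k)
  by_cases hG : G.IsStandard (N * k) k
  · have hz : zlabel ((j + 1 : ℤ) : ZMod (N * k)) = j % (N * k : ℕ) := by
      have h := zlabel_intCast (n := N * k) (Int.emod_nonneg j hn.ne') (Int.emod_lt_of_pos j hn)
      rw [← h]
      rw [Int.cast_add, Int.cast_add, ZMod.intCast_mod]
    rw [intY, map_smul, stripAction_of, LinearMap.smul_apply, stripGen, stripY_basis, smul_smul, hz]
    have hc := hG.1.content_add_mul (j % (N * k : ℕ)) (j / (N * k : ℕ))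
    rw [Int.emod_add_mul_ediv] at hc
    rw [hc, hq, Units.val_zpow_eq_zpow_val, ← zpow_mul, ← zpow_add₀ t.ne_zero]
    congr 2
    ring
  · rw [stripBasis_of_not_isStandard hG, map_zero, smul_zero]

/-- The `T_i` with `i ≠ 0` exchange labels inside a rectangle, hence act by the seminormal form of
the tableaux, and the `Y_i^{±1}` are diagonal. -/
theorem stripAction_rectEmb_mem (b : affineHecke (N * k) q t) (v : RectSpace K N k) :
    ∃ w, stripAction N k ht hq b (rectEmb K N k v) = rectEmb K N k w := by
  obtain ⟨b, hb⟩ := b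
  simp only
  revert v
  have hdiag : ∀ (f : Module.End K (StripSpace K N (N * k) k)) (c : RectSYT N k → K),
      (∀ R : RectSYT N k, f (stripBasis K (N * k) k (stripExt R.1)) =
        c R • stripBasis K (N * k) k (stripExt R.1)) →
      ∀ v, ∃ w, f (rectEmb K N k v) = rectEmb K N k w := by
    intro f c hf v
    refine ⟨Finsupp.linearCombination K (fun R : RectSYT N k => c R • rectBasis K R.1) v, ?_⟩
    refine LinearMap.congr_fun (f := f ∘ₗ rectEmb K N k) (g := rectEmb K N k ∘ₗ _)
      (rectSpace_hom_ext K fun R => ?_) v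
    have h1 : rectBasis K R.1 = Finsupp.single R 1 := dif_pos R.2
    rw [LinearMap.comp_apply, LinearMap.comp_apply, rectEmb_rectBasis, hf]
    conv_rhs => rw [h1, Finsupp.linearCombination_single, one_smul, map_smul, rectEmb_rectBasis]
  induction hb using Algebra.adjoin_induction with
  | mem x hx =>
    rcases hx with ⟨i, hi, rfl⟩ | ⟨i, rfl⟩ | ⟨i, rfl⟩
    · obtain ⟨a, ha, rfl⟩ := exists_succ_of_ne_zero hi
      exact fun v => ⟨_, stripAction_T ht hq ha v⟩
    · refine hdiag _ (fun R => (t : K) ^ (2 * (stripExt R.1).content (zlabel i))) fun R => ?_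
      rw [stripAction_of, stripGen, stripY_basis]
    · refine hdiag _ (fun R => (t : K) ^ (-(2 * (stripExt R.1).content (zlabel i)))) fun R => ?_
      rw [stripAction_of, stripGen, stripYInv_basis _ (stripExt_isStandard R.2)]
  | algebraMap r =>
    intro v
    exact ⟨r • v, by rw [AlgHom.commutes, Module.algebraMap_end_apply, map_smul]⟩
  | add x y _ _ hx hy =>
    intro v
    obtain ⟨w, hw⟩ := hx v
    obtain ⟨w', hw'⟩ := hy v
    exact ⟨w + w', by rw [map_add, LinearMap.add_apply, hw, hw', map_add]⟩
  | mul x y _ _ hx hy =>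
    intro v
    obtain ⟨w, hw⟩ := hy v
    obtain ⟨w', hw'⟩ := hx w
    exact ⟨w', by rw [map_mul, Module.End.mul_apply, hw, hw']⟩

/-- The representation is the restriction of the strip action to the stable image of `rectEmb`,
carried back by a linear left inverse `κ`. Stability of the image makes it multiplicative. -/
theorem exists_isRectangular :
    ∃ ρ : affineHecke (N * k) q t →ₐ[K] Module.End K (RectSpace K N k), IsRectangular ρ ∧
      ∀ b v, rectEmb K N k (ρ b v) = stripAction N k ht hq b (rectEmb K N k v) := by
  obtain ⟨κ, hκ⟩ := LinearMap.exists_leftInverse_of_injective (rectEmb K N k)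
    (LinearMap.ker_eq_bot.2 (rectEmb_injective K))
  have hκ' : ∀ v, κ (rectEmb K N k v) = v := LinearMap.congr_fun hκ
  have hκ'' : ∀ (b : affineHecke (N * k) q t) v,
      rectEmb K N k (κ (stripAction N k ht hq b (rectEmb K N k v))) =
      stripAction N k ht hq b (rectEmb K N k v) := by
    intro b v
    obtain ⟨w, hw⟩ := stripAction_rectEmb_mem ht hq b v
    rw [hw, hκ']
  let f : affineHecke (N * k) q t →ₗ[K] Module.End K (RectSpace K N k) :=
    { toFun := fun b => κ ∘ₗ stripAction N k ht hq b ∘ₗ rectEmb K N k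
      map_add' := fun a b => by
        refine LinearMap.ext fun v => ?_
        simp
      map_smul' := fun c b => by
        refine LinearMap.ext fun v => ?_
        simp }
  have hf : ∀ b v, f b v = κ (stripAction N k ht hq b (rectEmb K N k v)) := fun b v => rfl
  let ρ := AlgHom.ofLinearMap f
    (LinearMap.ext fun v => by
      rw [hf, OneMemClass.coe_one, map_one, Module.End.one_apply, hκ', Module.End.one_apply])
    (fun a b => LinearMap.ext fun v => by
      rw [hf, MulMemClass.coe_mul, map_mul, Module.End.mul_apply, Module.End.mul_apply, hf, hf,
        hκ''])
  have hρ : ∀ b v, rectEmb K N k (ρ b v) = stripAction N k ht hq b (rectEmb K N k v) := hκ''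
  refine ⟨ρ, ⟨fun i hi => LinearMap.ext fun v => rectEmb_injective K ?_, ?_⟩, hρ⟩
  · rw [hρ]
    exact stripAction_T ht hq hi v
  · refine rectSpace_hom_ext K fun R => rectEmb_injective K ?_
    rw [hρ, rectEmb_rectBasis, Module.End.one_apply, rectEmb_rectBasis]
    change stripAction N k ht hq (of _ _ _ _) _ = _
    rw [stripAction_of, stripGen, stripY_basis, zlabel_one, stripExt_content_zero R.2, mul_zero,
      zpow_zero, one_smul]

end

/-- The relation `T_i Y_i T_i = Y_{i+1}` propagates agreement from `Y_1` to all `Y_i`, and inverses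
are unique. -/
theorem IsRectangular.unique {ρ ρ' : affineHecke (N * k) q t →ₐ[K] Module.End K (RectSpace K N k)}
    (h : IsRectangular ρ) (h' : IsRectangular ρ') : ρ = ρ' := by
  have hT : ∀ (i : ZMod (N * k)) (hi : i ≠ 0),
      ρ (affineHecke.T (N * k) q t i hi) = ρ' (affineHecke.T (N * k) q t i hi) := by
    intro i hi
    obtain ⟨a, ha, rfl⟩ := exists_succ_of_ne_zero hi
    exact (h.1 a ha).trans (h'.1 a ha).symm
  have hY' : ∀ a : ℕ, a < N * k →
      ρ (affineHecke.Y (N * k) q t ((a + 1 : ℕ) : ZMod (N * k))) =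
        ρ' (affineHecke.Y (N * k) q t ((a + 1 : ℕ) : ZMod (N * k))) := by
    intro a
    induction a with
    | zero =>
      intro _
      rw [zero_add, Nat.cast_one, h.2, h'.2]
    | succ a ih =>
      intro ha
      have hne := natCast_succ_ne_zero_of_lt ha
      have key : affineHecke.Y (N * k) q t ((a + 1 + 1 : ℕ) : ZMod (N * k)) =
          affineHecke.T (N * k) q t ((a + 1 : ℕ) : ZMod (N * k)) hne *
            affineHecke.Y (N * k) q t ((a + 1 : ℕ) : ZMod (N * k)) *
            affineHecke.T (N * k) q t ((a + 1 : ℕ) : ZMod (N * k)) hne := by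
        have := RingQuot.mkAlgHom_rel K (Rel.T_Y_T (q := q) (t := t) _ hne)
        rw [map_mul, map_mul] at this
        rw [Nat.cast_succ (a + 1)]
        exact Subtype.ext this.symm
      rw [key, map_mul, map_mul, map_mul, map_mul, ih (by omega), hT]
  have hY : ∀ i : ZMod (N * k),
      ρ (affineHecke.Y (N * k) q t i) = ρ' (affineHecke.Y (N * k) q t i) := by
    intro i
    obtain ⟨a, ha⟩ := Int.eq_ofNat_of_zero_le (zlabel_nonneg i)
    have hl := zlabel_lt i
    have e := cast_zlabel i
    rw [ha] at hl e
    have e' : i = ((a + 1 : ℕ) : ZMod (N * k)) := by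
      rw [← e]
      push_cast
      rfl
    rw [e']
    exact hY' a (by exact_mod_cast hl)
  refine AlgHom.adjoin_ext fun x hx => ?_
  rcases hx with ⟨i, hi, rfl⟩ | ⟨i, rfl⟩ | ⟨i, rfl⟩
  · exact hT i hi
  · exact hY i
  · set z : affineHecke (N * k) q t :=
      ⟨of (N * k) q t (Gen.YInv i), Algebra.subset_adjoin (Or.inr (Or.inr ⟨i, rfl⟩))⟩
    have h1 : affineHecke.Y (N * k) q t i * z = 1 := Subtype.ext (Y_mul_YInv (N * k) q t i)
    have h2 : z * affineHecke.Y (N * k) q t i = 1 := Subtype.ext (YInv_mul_Y (N * k) q t i)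
    have h3 : ρ z * ρ (affineHecke.Y (N * k) q t i) = 1 := by rw [← map_mul, h2, map_one]
    have h4 : ρ' (affineHecke.Y (N * k) q t i) * ρ' z = 1 := by rw [← map_mul, h1, map_one]
    rw [← hY] at h4
    exact left_inv_eq_right_inv h3 h4

theorem IsRectangular.rectEmb_apply (ht : ∀ m : ℕ, 0 < m → t ^ m ≠ 1)
    (hq : q = t ^ (-(2 * (k : ℤ))))
    {ρ : affineHecke (N * k) q t →ₐ[K] Module.End K (RectSpace K N k)} (h : IsRectangular ρ)
    (b : affineHecke (N * k) q t) (v : RectSpace K N k) :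
    rectEmb K N k (ρ b v) = stripAction N k ht hq b (rectEmb K N k v) := by
  obtain ⟨ρ', hρ', hb⟩ := exists_isRectangular (N := N) ht hq
  rw [h.unique hρ', hb]

end Rectangular

/-! ### Words in the generators, applied to the rectangular representation -/

namespace StripFilling

variable {N n k : ℕ}

/-- The index of the rectangle with `k` columns that contains a given label. -/
def block (k : ℕ) (G : StripFilling N) (j : ℤ) : ℤ := (G j).2 / (k : ℤ)

theorem block_swap (i : ℤ) (G : StripFilling N) :
    (G.swap n i).block k = G.block k ∘ perSwap n i := rfl

theorem block_shift (d j : ℤ) (G : StripFilling N) :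
    (G.shift d).block k j = G.block k (j - d) := rfl

theorem IsPeriodic.block_add_mul [NeZero k] {G : StripFilling N} (hG : G.IsPeriodic n k)
    (j c : ℤ) : G.block k (j + n * c) = G.block k j + c := by
  have hk : (k : ℤ) ≠ 0 := by exact_mod_cast NeZero.ne k
  simp only [block, hG.apply_add_mul]
  rw [Int.add_mul_ediv_left _ _ hk]

/-- A filling is standard on rectangles if it increases along rows and down columns within each
of the rectangles with `k` columns. -/
def IsBlockStandard (n k : ℕ) (G : StripFilling N) : Prop :=
  G.IsPeriodic n k ∧ ∀ i j, G.block k i = G.block k j → G i ≤ G j → i ≤ j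

theorem IsStandard.isBlockStandard {G : StripFilling N} (hG : G.IsStandard n k) :
    G.IsBlockStandard n k := ⟨hG.1, fun i j _ h => hG.2 i j h⟩

/-- The exchanged labels lie in different rectangles, so the order of the labels inside each
rectangle is unchanged. -/
theorem IsBlockStandard.swap [NeZero k] {G : StripFilling N} (hG : G.IsBlockStandard n k)
    (hn : 2 ≤ n) {i : ℤ} (hi : G.block k i < G.block k (i + 1)) :
    (G.swap n i).IsBlockStandard n k := by
  refine ⟨hG.1.swap i, fun a b hb hab => ?_⟩
  simp only [block_swap, Function.comp_apply, swap_apply] at hb hab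
  by_contra! hlt
  by_cases hc : a = b + 1 ∧ (n : ℤ) ∣ b - i
  · obtain ⟨rfl, c, hc⟩ := hc
    obtain rfl : b = i + n * c := by linarith
    rw [perSwap_add_mul, perSwap_self hn, show i + n * c + 1 = i + 1 + n * c by ring,
      perSwap_add_mul, perSwap_succ hn, hG.1.block_add_mul, hG.1.block_add_mul] at hb
    omega
  · have h1 := perSwap_lt_perSwap hlt hc
    have h2 := hG.2 _ _ hb hab
    omega

end StripFilling

theorem stripExt_block_eq {N k : ℕ} [NeZero N] [NeZero k] (R : Fin N × Fin k ≃ Fin (N * k))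
    (j : ℤ) : (stripExt R).block k j = j / ((N * k : ℕ) : ℤ) := stripExt_block R j

section Words

open DAHA StripFilling

variable {K : Type*} [Field K] {N k : ℕ} [NeZero N] [NeZero k] (q t : Kˣ)
  {M : Type*} [AddCommGroup M] [Module K M] [Module (Alg (N * k) q t) M]

/-- The vectors `T_{i₁} ⋯ T_{iᵣ} π^d v_R` such that each factor `T_i` exchanges labels `i`, `i + 1`
that lie in different rectangles, in increasing order, together with the filling of the strip that
belongs to the word. -/
inductive IsWord (e : RectSpace K N k →ₗ[K] M) : ℕ → StripFilling N → M → Prop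
  | base (d : ℤ) (R : RectSYT N k) : IsWord e 1 ((stripExt R.1).shift d)
      (((piUnit (N * k) q t ^ d : (Alg (N * k) q t)ˣ) : Alg (N * k) q t) • e (rectBasis K R.1))
  | step {r : ℕ} {G : StripFilling N} {u : M} (i : ℤ) (hn : 2 ≤ N * k)
      (hi : G.block k i < G.block k (i + 1)) (hu : IsWord e r G u) :
      IsWord e (r + 1) (G.swap (N * k) i) (intT (N * k) q t i • u)

/-- The span of the words of given length that belong to a given distribution of the labels to
rectangles. -/
def wordSpan (e : RectSpace K N k →ₗ[K] M) (r : ℕ) (m : ℤ → ℤ) : Submodule K M :=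
  Submodule.span K {u | ∃ G : StripFilling N, G.block k = m ∧ IsWord q t e r G u}

variable {q t} {e : RectSpace K N k →ₗ[K] M}

theorem IsWord.pos {r : ℕ} {G : StripFilling N} {u : M} (h : IsWord q t e r G u) : 0 < r := by
  cases h <;> omega

theorem IsWord.isBlockStandard {r : ℕ} {G : StripFilling N} {u : M} (h : IsWord q t e r G u) :
    G.IsBlockStandard (N * k) k := by
  induction h with
  | base d R => exact ((stripExt_isStandard R.2).shift d).isBlockStandard
  | step i hn hi _ ih => exact ih.swap hn hi

theorem wordSpan_zero (m : ℤ → ℤ) : wordSpan q t e 0 m = ⊥ := by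
  rw [wordSpan, Submodule.span_eq_bot]
  rintro u ⟨G, -, h⟩
  exact absurd h.pos (lt_irrefl 0)

theorem base_mem_wordSpan (d : ℤ) (v : RectSpace K N k) [IsScalarTower K (Alg (N * k) q t) M] :
    ((piUnit (N * k) q t ^ d : (Alg (N * k) q t)ˣ) : Alg (N * k) q t) • e v ∈
      wordSpan q t e 1 fun j => (j - d) / ((N * k : ℕ) : ℤ) := by
  induction v using Finsupp.induction_linear with
  | zero => simp
  | add v w hv hw =>
    rw [map_add, smul_add]
    exact add_mem hv hw
  | single R c =>
    have h1 : rectBasis K R.1 = Finsupp.single R 1 := dif_pos R.2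
    have h2 : Finsupp.single R c = c • rectBasis K R.1 := by
      rw [h1, Finsupp.smul_single, smul_eq_mul, mul_one]
    rw [h2, map_smul, smul_algebra_smul_comm]
    refine Submodule.smul_mem _ _ (Submodule.subset_span ⟨_, ?_, IsWord.base d R⟩)
    ext j
    rw [block_shift, stripExt_block_eq]

variable [IsScalarTower K (Alg (N * k) q t) M]

theorem intT_smul_mem_of_lt (hn : 2 ≤ N * k) {r : ℕ} {m : ℤ → ℤ} {i : ℤ} (hi : m i < m (i + 1))
    {m' : ℤ → ℤ} (hm : m ∘ perSwap (N * k) i = m')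
    {x : M} (hx : x ∈ wordSpan q t e r m) :
    intT (N * k) q t i • x ∈ wordSpan q t e (r + 1) m' := by
  induction hx using Submodule.span_induction with
  | mem u hu =>
    obtain ⟨G, rfl, hu⟩ := hu
    exact Submodule.subset_span ⟨_, by rw [block_swap, hm], hu.step i hn hi⟩
  | zero => simp
  | add x y _ _ hx hy =>
    rw [smul_add]
    exact add_mem hx hy
  | smul c x _ hx =>
    rw [smul_algebra_smul_comm]
    exact Submodule.smul_mem _ _ hx

omit [NeZero N] [NeZero k] in
theorem comp_perSwap_comp (hn : 2 ≤ N * k) (m : ℤ → ℤ) (i : ℤ) :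
    (m ∘ perSwap (N * k) i) ∘ perSwap (N * k) i = m := by
  ext j
  simp [perSwap_perSwap hn]

/-- A word whose last letter is not `T_i` is brought to a form whose last letter is `T_i`. -/
theorem exists_eq_intT_smul (hn : 2 ≤ N * k) (r : ℕ) : ∀ (m : ℤ → ℤ) (i : ℤ), m (i + 1) < m i →
    ∀ x ∈ wordSpan q t e (r + 1) m, ∃ y ∈ wordSpan q t e r (m ∘ perSwap (N * k) i),
      x = intT (N * k) q t i • y := by
  induction r using Nat.strong_induction_on with
  | _ r IH =>
  intro m i hi x hx
  induction hx using Submodule.span_induction with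
  | zero => exact ⟨0, zero_mem _, by simp⟩
  | add x y _ _ hx hy =>
    obtain ⟨x', hx', rfl⟩ := hx
    obtain ⟨y', hy', rfl⟩ := hy
    exact ⟨x' + y', add_mem hx' hy', by rw [smul_add]⟩
  | smul c x _ hx =>
    obtain ⟨x', hx', rfl⟩ := hx
    exact ⟨c • x', Submodule.smul_mem _ _ hx', by rw [smul_algebra_smul_comm]⟩
  | mem u hu =>
    obtain ⟨G, rfl, hu⟩ := hu
    have hper := hu.isBlockStandard.1
    cases hu with
    -- In a word without letters `T` the rectangle index increases weakly with the label, so there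
    -- is no descent.
    | base d R =>
      exfalso
      rw [block_shift, block_shift, stripExt_block_eq, stripExt_block_eq] at hi
      refine absurd (Int.ediv_le_ediv ?_ ?_) (not_le.2 hi)
      · omega
      · omega
    | @step _ G u j _ hj hu =>
      generalize hm : (G.swap (N * k) j).block k = m at hi
      have hdj : m (j + 1) < m j := by
        rw [← hm, block_swap]
        simpa [perSwap_self hn, perSwap_succ hn] using hj
      have hmper : ∀ a c : ℤ, m (a + (N * k : ℕ) * c) = m a + c := fun a c => by
        rw [← hm, hper.block_add_mul]
      have hG : G.block k = m ∘ perSwap (N * k) j := by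
        rw [← hm, block_swap, comp_perSwap_comp hn]
      have hu' : u ∈ wordSpan q t e r (m ∘ perSwap (N * k) j) :=
        Submodule.subset_span ⟨G, hG, hu⟩
      obtain ⟨r, rfl⟩ : ∃ r', r = r' + 1 := ⟨r - 1, by have := hu.pos; omega⟩
      clear hu hG hj hper
      by_cases h0 : ((N * k : ℕ) : ℤ) ∣ j - i
      · rw [perSwap_congr h0] at hu'
        exact ⟨u, hu', by rw [intT_congr h0]⟩
      by_cases h1 : ((N * k : ℕ) : ℤ) ∣ j - (i + 1)
      · have hd : m (i + 1 + 1) < m (i + 1) := by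
          obtain ⟨c, hc⟩ := h1
          rw [show j = i + 1 + (N * k : ℕ) * c by linarith,
            show i + 1 + (N * k : ℕ) * c + 1 = i + 1 + 1 + (N * k : ℕ) * c by ring, hmper,
            hmper] at hdj
          omega
        -- For `n = 2` periodicity gives `m (i + 2) = m i + 1`, against `m (i + 2) < m (i + 1) < m
        -- i`.
        have h3 : 3 ≤ N * k := by
          by_contra! h
          have := hmper i 1
          rw [show ((N * k : ℕ) : ℤ) = 2 by omega, show i + 2 * 1 = i + 1 + 1 by ring] at this
          omega
        rw [perSwap_congr h1] at hu'
        rw [intT_congr h1]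
        -- Now `m` decreases along `i, i + 1, i + 2`. Two uses of the induction hypothesis give
        -- `T_{i+1} T_i T_{i+1} y`, and the braid relation moves a `T_i` to the front.
        obtain ⟨x, hx, rfl⟩ := IH r (by omega) _ i (by
          simp only [Function.comp_apply, perSwap_self hn, perSwap_succ_self h3]
          omega) _ hu'
        cases r with
        | zero =>
          rw [wordSpan_zero, Submodule.mem_bot] at hx
          exact ⟨0, zero_mem _, by simp [hx]⟩
        | succ r =>
          obtain ⟨y, hy, rfl⟩ := IH r (by omega) _ (i + 1) (by
            simp only [Function.comp_apply, perSwap_succ hn, perSwap_succ_self h3,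
              perSwap_add_two h3]
            omega) _ hx
          refine ⟨intT (N * k) q t (i + 1) • intT (N * k) q t i • y, ?_, ?_⟩
          · refine intT_smul_mem_of_lt hn (m := m ∘ perSwap (N * k) i ∘ perSwap (N * k) (i + 1))
              ?_ ?_ (intT_smul_mem_of_lt hn ?_ ?_ hy)
            · simp only [Function.comp_apply, perSwap_self hn, perSwap_succ hn, perSwap_add_two h3]
              omega
            · ext j
              simp only [Function.comp_apply, perSwap_perSwap hn]
            · simp only [Function.comp_apply, perSwap_self hn, perSwap_succ hn, perSwap_add_two h3,
                perSwap_succ_self h3]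
              omega
            · ext j
              simp only [Function.comp_apply]
              rw [← perSwap_braid h3, perSwap_perSwap hn]
          · simp only [← mul_smul]
            congr 1
            simp only [← mul_assoc]
            exact (intT_braid (by omega) i).symm
      by_cases h2 : ((N * k : ℕ) : ℤ) ∣ i - (j + 1)
      · obtain ⟨a, rfl⟩ : ∃ a, i = a + 1 := ⟨i - 1, by ring⟩
        have h2' : ((N * k : ℕ) : ℤ) ∣ j - a := by
          rw [dvd_sub_comm]
          simpa using h2
        have hd : m (a + 1) < m a := by
          obtain ⟨c, hc⟩ := h2'
          rw [show j = a + (N * k : ℕ) * c by linarith,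
            show a + (N * k : ℕ) * c + 1 = a + 1 + (N * k : ℕ) * c by ring, hmper,
            hmper] at hdj
          omega
        have h3 : 3 ≤ N * k := by
          by_contra! h
          have := hmper a 1
          rw [show ((N * k : ℕ) : ℤ) = 2 by omega, show a + 2 * 1 = a + 1 + 1 by ring] at this
          omega
        rw [perSwap_congr h2'] at hu'
        rw [intT_congr h2']
        obtain ⟨x, hx, rfl⟩ := IH r (by omega) _ (a + 1) (by
          simp only [Function.comp_apply, perSwap_succ hn, perSwap_add_two h3]
          omega) _ hu'
        cases r with
        | zero =>
          rw [wordSpan_zero, Submodule.mem_bot] at hx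
          exact ⟨0, zero_mem _, by simp [hx]⟩
        | succ r =>
          obtain ⟨y, hy, rfl⟩ := IH r (by omega) _ a (by
            simp only [Function.comp_apply, perSwap_self hn, perSwap_succ_self h3,
              perSwap_add_two h3]
            omega) _ hx
          refine ⟨intT (N * k) q t a • intT (N * k) q t (a + 1) • y, ?_, ?_⟩
          · refine intT_smul_mem_of_lt hn (m := m ∘ perSwap (N * k) (a + 1) ∘ perSwap (N * k) a)
              ?_ ?_ (intT_smul_mem_of_lt hn ?_ ?_ hy)
            · simp only [Function.comp_apply, perSwap_self hn, perSwap_succ hn,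
                perSwap_succ_self h3]
              omega
            · ext j
              simp only [Function.comp_apply, perSwap_perSwap hn]
            · simp only [Function.comp_apply, perSwap_self hn, perSwap_succ hn, perSwap_add_two h3,
                perSwap_succ_self h3]
              omega
            · ext j
              simp only [Function.comp_apply]
              rw [perSwap_braid h3, perSwap_perSwap hn]
          · simp only [← mul_smul]
            congr 1
            simp only [← mul_assoc]
            exact intT_braid (by omega) a
      · obtain ⟨e1, e2, e3, e4⟩ := perSwap_of_far h0 h1 h2
        -- For `n = 2` one of the residue conditions excluded above would hold, so the commutation
        -- relation is available.
        have h3 : N * k ≠ 2 := by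
          rintro h
          rw [h] at h0 h1
          push_cast at h0 h1
          omega
        obtain ⟨x, hx, rfl⟩ := IH r (by omega) _ i (by
          simp only [Function.comp_apply, e3, e4]
          exact hi) _ hu'
        refine ⟨intT (N * k) q t j • x, intT_smul_mem_of_lt hn ?_ ?_ hx, ?_⟩
        · simp only [Function.comp_apply, e1, e2, perSwap_self hn, perSwap_succ hn]
          exact hdj
        · ext a
          simp only [Function.comp_apply]
          rw [perSwap_comm hn h0 h1 h2, perSwap_perSwap hn]
        · rw [smul_smul, smul_smul, intT_comm h3 h1 h2]

/-- Write `x = T_i y` by the exchange lemma and apply the quadratic relation to `T_i T_i y`. -/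
theorem intT_smul_mem_of_gt (hn : 2 ≤ N * k) {r : ℕ} {m : ℤ → ℤ} {i : ℤ} (hi : m (i + 1) < m i)
    {x : M} (hx : x ∈ wordSpan q t e (r + 1) m) :
    intT (N * k) q t i • x ∈
      wordSpan q t e (r + 1) m ⊔ wordSpan q t e r (m ∘ perSwap (N * k) i) := by
  obtain ⟨y, hy, hxy⟩ := exists_eq_intT_smul hn r m i hi x hx
  have : intT (N * k) q t i • x = ((t : K) - (t : K)⁻¹) • x + y := by
    rw [hxy, ← mul_smul, intT_mul_intT, add_smul, one_smul, smul_assoc]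
  rw [this]
  exact Submodule.add_mem_sup (Submodule.smul_mem _ _ hx) hy

/-- Labels of one rectangle: `T_i` is pushed through the word by braid and commutation relations,
possibly changing its index, until it reaches the rectangular representation and is absorbed there.
-/
theorem intT_smul_mem_of_eq (hn : 2 ≤ N * k)
    (hT : ∀ i : ℤ, ¬ ((N * k : ℕ) : ℤ) ∣ i + 1 → ∀ v, ∃ w, intT (N * k) q t i • e v = e w)
    (r : ℕ) : ∀ (m : ℤ → ℤ) (i : ℤ), m i = m (i + 1) →
    ∀ x ∈ wordSpan q t e r m, intT (N * k) q t i • x ∈ wordSpan q t e r m := by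
  induction r using Nat.strong_induction_on with
  | _ r IH =>
  intro m i hi x hx
  induction hx using Submodule.span_induction with
  | zero => simp
  | add x y _ _ hx hy =>
    rw [smul_add]
    exact add_mem hx hy
  | smul c x _ hx =>
    rw [smul_algebra_smul_comm]
    exact Submodule.smul_mem _ _ hx
  | mem u hu =>
    obtain ⟨G, rfl, hu⟩ := hu
    have hper := hu.isBlockStandard.1
    cases hu with
    | base d R =>
      have hb : ((stripExt R.1).shift d).block k = fun j => (j - d) / ((N * k : ℕ) : ℤ) := by
        ext j
        rw [block_shift, stripExt_block_eq]
      rw [hb] at hi ⊢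
      -- Moving `T_i` past `π^d` gives `T_{i-d}`. Equal rectangle indices say that this is not the
      -- affine generator, so it acts on the rectangular representation.
      have hd : ¬ ((N * k : ℕ) : ℤ) ∣ i - d + 1 := fun hd => by
        have := add_one_ediv_of_dvd hd
        simp only at hi
        rw [show i + 1 - d = i - d + 1 by ring] at hi
        omega
      obtain ⟨w, hw⟩ := hT (i - d) hd (rectBasis K R.1)
      have := piUnit_zpow_mul_intT (N * k) q t d (i - d)
      rw [sub_add_cancel] at this
      rw [smul_smul, ← this, mul_smul, hw]
      exact base_mem_wordSpan d w
    | @step r G u j _ hj hu =>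
      generalize hm : (G.swap (N * k) j).block k = m at hi
      have hdj : m (j + 1) < m j := by
        rw [← hm, block_swap]
        simpa [perSwap_self hn, perSwap_succ hn] using hj
      have hmper : ∀ a c : ℤ, m (a + (N * k : ℕ) * c) = m a + c := fun a c => by
        rw [← hm, hper.block_add_mul]
      have hG : G.block k = m ∘ perSwap (N * k) j := by
        rw [← hm, block_swap, comp_perSwap_comp hn]
      have hu' : u ∈ wordSpan q t e r (m ∘ perSwap (N * k) j) :=
        Submodule.subset_span ⟨G, hG, hu⟩
      obtain ⟨r, rfl⟩ : ∃ r', r = r' + 1 := ⟨r - 1, by have := hu.pos; omega⟩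
      clear hu hG hj hper
      by_cases h0 : ((N * k : ℕ) : ℤ) ∣ j - i
      · obtain ⟨c, hc⟩ := h0
        rw [show j = i + (N * k : ℕ) * c by linarith,
          show i + (N * k : ℕ) * c + 1 = i + 1 + (N * k : ℕ) * c by ring, hmper, hmper] at hdj
        omega
      by_cases h1 : ((N * k : ℕ) : ℤ) ∣ j - (i + 1)
      · have hd : m (i + 1 + 1) < m (i + 1) := by
          obtain ⟨c, hc⟩ := h1
          rw [show j = i + 1 + (N * k : ℕ) * c by linarith,
            show i + 1 + (N * k : ℕ) * c + 1 = i + 1 + 1 + (N * k : ℕ) * c by ring, hmper,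
            hmper] at hdj
          omega
        have h3 : 3 ≤ N * k := by
          by_contra! h
          have := hmper i 1
          rw [show ((N * k : ℕ) : ℤ) = 2 by omega, show i + 2 * 1 = i + 1 + 1 by ring] at this
          omega
        rw [perSwap_congr h1] at hu'
        rw [intT_congr h1]
        -- After `T_i T_{i+1} T_i x = T_{i+1} T_i T_{i+1} x` the innermost letter again meets two
        -- labels of one rectangle, and the two outer letters lengthen the word.
        obtain ⟨x, hx, rfl⟩ := exists_eq_intT_smul hn r _ i (by
          simp only [Function.comp_apply, perSwap_self hn, perSwap_succ_self h3]
          omega) _ hu'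
        have hx' := IH r (by omega) _ (i + 1) (by
          simp only [Function.comp_apply, perSwap_succ hn, perSwap_succ_self h3,
            perSwap_add_two h3]
          omega) _ hx
        rw [smul_smul, smul_smul, intT_braid (by omega), mul_smul, mul_smul]
        refine intT_smul_mem_of_lt hn ?_ (comp_perSwap_comp hn m (i + 1))
          (intT_smul_mem_of_lt hn ?_ (comp_perSwap_comp hn _ i) hx')
        · simp only [Function.comp_apply, perSwap_self hn, perSwap_succ hn]
          omega
        · simp only [Function.comp_apply, perSwap_self hn, perSwap_succ hn, perSwap_succ_self h3]
          omega
      by_cases h2 : ((N * k : ℕ) : ℤ) ∣ i - (j + 1)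
      · obtain ⟨a, rfl⟩ : ∃ a, i = a + 1 := ⟨i - 1, by ring⟩
        have h2' : ((N * k : ℕ) : ℤ) ∣ j - a := by
          rw [dvd_sub_comm]
          simpa using h2
        have hd : m (a + 1) < m a := by
          obtain ⟨c, hc⟩ := h2'
          rw [show j = a + (N * k : ℕ) * c by linarith,
            show a + (N * k : ℕ) * c + 1 = a + 1 + (N * k : ℕ) * c by ring, hmper,
            hmper] at hdj
          omega
        have h3 : 3 ≤ N * k := by
          by_contra! h
          have := hmper a 1
          rw [show ((N * k : ℕ) : ℤ) = 2 by omega, show a + 2 * 1 = a + 1 + 1 by ring] at this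
          omega
        rw [perSwap_congr h2'] at hu'
        rw [intT_congr h2']
        obtain ⟨x, hx, rfl⟩ := exists_eq_intT_smul hn r _ (a + 1) (by
          simp only [Function.comp_apply, perSwap_succ hn, perSwap_add_two h3]
          omega) _ hu'
        have hx' := IH r (by omega) _ a (by
          simp only [Function.comp_apply, perSwap_self hn, perSwap_succ_self h3,
            perSwap_add_two h3]
          omega) _ hx
        rw [smul_smul, smul_smul, ← intT_braid (by omega), mul_smul, mul_smul]
        refine intT_smul_mem_of_lt hn ?_ (comp_perSwap_comp hn m a)
          (intT_smul_mem_of_lt hn ?_ (comp_perSwap_comp hn _ (a + 1)) hx')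
        · simp only [Function.comp_apply, perSwap_self hn, perSwap_succ hn]
          omega
        · simp only [Function.comp_apply, perSwap_self hn, perSwap_succ hn, perSwap_add_two h3]
          omega
      · obtain ⟨e1, e2, e3, e4⟩ := perSwap_of_far h0 h1 h2
        have h3 : N * k ≠ 2 := by
          rintro h
          rw [h] at h0 h1
          push_cast at h0 h1
          omega
        have hx' := IH (r + 1) (by omega) _ i (by
          simp only [Function.comp_apply, e3, e4]
          exact hi) _ hu'
        rw [smul_smul, intT_comm h3 h1 h2, mul_smul]
        refine intT_smul_mem_of_lt hn ?_ (comp_perSwap_comp hn m j) hx'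
        simp only [Function.comp_apply, perSwap_self hn, perSwap_succ hn]
        exact hdj

end Words

/-! ### The degenerate case `n = 1` -/

namespace DAHA

/-- The conjugate `w = y⁻¹ x y` satisfies the same quadratic relation as `x`, and `w x = t²`.
Computing `w² x²` in two ways gives `t⁴ = (t - t⁻¹)(t² + 1) x + 1`, a linear equation for `x` with
invertible leading coefficient. -/
theorem eq_algebraMap_of_conj {K A : Type*} [Field K] [Ring A] [Algebra K A] {t : Kˣ}
    (ht : ∀ m : ℕ, 0 < m → t ^ m ≠ 1) {x y z : A} (hx : x * x = ((t : K) - (t : K)⁻¹) • x + 1)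
    (hyz : y * z = 1) (hzy : z * y = 1) (h : x * y * x = ((t : K) ^ 2) • y) :
    x = algebraMap K A t := by
  have h0 : (t : K) ≠ 0 := t.ne_zero
  have h4 : (t : K) ^ 4 - 1 ≠ 0 := by
    have := zpow_two_mul_ne_one ht (show (2 : ℤ) ≠ 0 by norm_num)
    rw [sub_ne_zero]
    exact_mod_cast this
  set w := z * x * y with hw
  have hww : w * w = ((t : K) - (t : K)⁻¹) • w + 1 := by
    calc w * w = z * x * (y * z) * x * y := by simp only [hw, mul_assoc]
      _ = z * (x * x) * y := by rw [hyz, mul_one, mul_assoc z]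
      _ = _ := by
        rw [hx, mul_add, add_mul, mul_one, hzy, mul_smul_comm, smul_mul_assoc]
  have hwx : w * x = ((t : K) ^ 2) • (1 : A) := by
    calc w * x = z * (x * y * x) := by simp only [hw, mul_assoc]
      _ = _ := by rw [h, mul_smul_comm, hzy]
  have e1 : w * w * x * x = ((t : K) ^ 4) • (1 : A) := by
    calc w * w * x * x = w * (w * x) * x := by simp only [mul_assoc]
      _ = _ := by
        rw [hwx, mul_smul_comm, mul_one, smul_mul_assoc, hwx, smul_smul]
        congr 1
        ring
  have e2 : w * w * x * x = (((t : K) - (t : K)⁻¹) * ((t : K) ^ 2 + 1)) • x + (1 : A) := by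
    rw [hww, add_mul, add_mul, one_mul, smul_mul_assoc, smul_mul_assoc, hwx, smul_mul_assoc,
      one_mul, hx, ← add_assoc, smul_smul, ← add_smul]
    congr 2
    ring
  rw [e1] at e2
  have e3 : ((t : K) ^ 4 - 1) • (x - algebraMap K A t) = 0 := by
    have e4 : (t : K) * (((t : K) - (t : K)⁻¹) * ((t : K) ^ 2 + 1)) = (t : K) ^ 4 - 1 := by
      field_simp
      ring
    rw [smul_sub, ← e4, ← smul_smul, eq_sub_of_add_eq e2.symm, e4, Algebra.algebraMap_eq_smul_one,
      smul_sub, smul_smul, smul_smul, ← sub_smul, ← sub_smul]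
    rw [show (t : K) * (t : K) ^ 4 - t - ((t : K) ^ 4 - 1) * t = 0 by ring, zero_smul]
  exact sub_eq_zero.1 ((smul_eq_zero.1 e3).resolve_left h4)

theorem intT_eq_algebraMap {K : Type*} [Field K] {n : ℕ} {q t : Kˣ}
    (ht : ∀ m : ℕ, 0 < m → t ^ m ≠ 1) (hn : n = 1) (hq : (q : K)⁻¹ = (t : K) ^ 2) (i : ℤ) :
    intT n q t i = algebraMap K (Alg n q t) t := by
  have : NeZero n := ⟨by omega⟩
  have h := intT_intY_intT n q t i
  have h' : intY n q t (i + 1) = ((t : K) ^ 2) • intY n q t i := by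
    subst hn
    rw [intY, intY, smul_smul, ← hq, ← zpow_neg_one, ← zpow_add₀ q.ne_zero]
    have e1 : -((i + 1) / ((1 : ℕ) : ℤ)) = -1 + -(i / ((1 : ℕ) : ℤ)) := by
      simp
    have e2 : ((i + 1 + 1 : ℤ) : ZMod 1) = ((i + 1 : ℤ) : ZMod 1) := Subsingleton.elim _ _
    rw [e1, e2]
  rw [h'] at h
  exact eq_algebraMap_of_conj ht (intT_mul_intT n q t i) (intY_mul_intYInv n q t i)
    (intYInv_mul_intY n q t i) h

end DAHA

/-! ### The length filtration and the triangular action of the `Y_j` -/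

section WordFiltration

open DAHA StripFilling

variable {K : Type*} [Field K] {N k : ℕ} [NeZero N] [NeZero k] (q t : Kˣ)
  {M : Type*} [AddCommGroup M] [Module K M] [Module (Alg (N * k) q t) M]

/-- The span of the words of bounded length. -/
def wordFil (e : RectSpace K N k →ₗ[K] M) (r : ℕ) : Submodule K M :=
  Submodule.span K {u | ∃ r' ≤ r, ∃ G : StripFilling N, IsWord q t e r' G u}

/-- The span of all words. -/
def allWords (e : RectSpace K N k →ₗ[K] M) : Submodule K M :=
  Submodule.span K {u | ∃ (r : ℕ) (G : StripFilling N), IsWord q t e r G u}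

variable {q t} {e : RectSpace K N k →ₗ[K] M}

theorem wordSpan_le_wordFil {r r' : ℕ} (h : r' ≤ r) (m : ℤ → ℤ) :
    wordSpan q t e r' m ≤ wordFil q t e r :=
  Submodule.span_mono fun _ ⟨G, _, hu⟩ => ⟨r', h, G, hu⟩

theorem wordFil_mono {r r' : ℕ} (h : r' ≤ r) : wordFil q t e r' ≤ wordFil q t e r :=
  Submodule.span_mono fun _ ⟨s, hs, hu⟩ => ⟨s, hs.trans h, hu⟩

theorem wordFil_le_allWords (r : ℕ) : wordFil q t e r ≤ allWords q t e :=
  Submodule.span_mono fun _ ⟨s, _, hu⟩ => ⟨s, hu⟩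

theorem IsWord.mem_wordFil {r : ℕ} {G : StripFilling N} {u : M} (h : IsWord q t e r G u) :
    u ∈ wordFil q t e r := Submodule.subset_span ⟨r, le_rfl, G, h⟩

variable [IsScalarTower K (Alg (N * k) q t) M]

omit [NeZero N] [NeZero k] in
/-- A linear operator that maps a spanning set into a submodule maps the span into it. -/
theorem smul_mem_of_mem_span {s : Set M} {p : Submodule K M} (a : Alg (N * k) q t)
    (h : ∀ u ∈ s, a • u ∈ p) {u : M} (hu : u ∈ Submodule.span K s) : a • u ∈ p := by
  induction hu using Submodule.span_induction with
  | mem u hu => exact h u hu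
  | zero => simp
  | add x y _ _ hx hy =>
    rw [smul_add]
    exact add_mem hx hy
  | smul c x _ hx =>
    rw [smul_algebra_smul_comm]
    exact p.smul_mem _ hx

omit [IsScalarTower K (Alg (N * k) q t) M] in
theorem IsWord.shift {r : ℕ} {G : StripFilling N} {u : M} (h : IsWord q t e r G u) (d : ℤ) :
    IsWord q t e r (G.shift d)
      (((piUnit (N * k) q t ^ d : (Alg (N * k) q t)ˣ) : Alg (N * k) q t) • u) := by
  induction h with
  | base c R =>
    rw [shift_shift, smul_smul, ← Units.val_mul, ← zpow_add, add_comm d c]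
    exact IsWord.base (c + d) R
  | step i hn hi hu ih =>
    rw [swap_shift, smul_smul, piUnit_zpow_mul_intT, mul_smul]
    refine ih.step _ hn ?_
    rw [block_shift, block_shift, show i + d + 1 - d = i + 1 by ring, add_sub_cancel_right]
    exact hi

variable (ht : ∀ m : ℕ, 0 < m → t ^ m ≠ 1) (hq : q = t ^ (-(2 * (k : ℤ))))
  (hT : ∀ i : ℤ, ¬ ((N * k : ℕ) : ℤ) ∣ i + 1 → ∀ v, ∃ w, intT (N * k) q t i • e v = e w)
include ht hq hT

theorem intT_smul_mem_wordFil (r : ℕ) (i : ℤ) {u : M} (hu : u ∈ wordFil q t e r) :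
    intT (N * k) q t i • u ∈ wordFil q t e (r + 1) := by
  by_cases hn : 2 ≤ N * k
  · refine smul_mem_of_mem_span _ ?_ hu
    rintro u ⟨s, hs, G, hu⟩
    have hu' : u ∈ wordSpan q t e s (G.block k) := Submodule.subset_span ⟨G, rfl, hu⟩
    rcases lt_trichotomy (G.block k i) (G.block k (i + 1)) with h | h | h
    · exact wordSpan_le_wordFil (by omega) _ (intT_smul_mem_of_lt hn h rfl hu')
    · exact wordSpan_le_wordFil (by omega) _ (intT_smul_mem_of_eq hn hT _ _ _ h _ hu')
    · obtain ⟨s, rfl⟩ : ∃ s', s = s' + 1 := ⟨s - 1, by have := hu.pos; omega⟩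
      have hle : wordSpan q t e (s + 1) (G.block k) ⊔
          wordSpan q t e s (G.block k ∘ perSwap (N * k) i) ≤ wordFil q t e (r + 1) :=
        sup_le (wordSpan_le_wordFil (by omega) _) (wordSpan_le_wordFil (by omega) _)
      exact hle (intT_smul_mem_of_gt hn h hu')
  · have hN := NeZero.pos N
    have hk := NeZero.pos k
    have h1 : N * k = 1 := by
      have := Nat.mul_pos hN hk
      omega
    have hk1 : k = 1 := Nat.eq_one_of_mul_eq_one_left h1
    have hq' : (q : K)⁻¹ = (t : K) ^ 2 := by
      rw [hq, Units.val_zpow_eq_zpow_val, zpow_neg, inv_inv, hk1]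
      norm_cast
    rw [intT_eq_algebraMap ht h1 hq', algebraMap_smul]
    exact Submodule.smul_mem _ _ (wordFil_mono (Nat.le_succ r) hu)

variable (hY : ∀ (j : ℤ) (R : RectSYT N k), intY (N * k) q t j • e (rectBasis K R.1) =
    ((t : K) ^ (2 * (stripExt R.1).content j)) • e (rectBasis K R.1))
include hY

/-- The `Y_j` act on words in a triangular way. -/
theorem IsWord.intY_smul_sub_mem {r : ℕ} {G : StripFilling N} {u : M} (h : IsWord q t e r G u) :
    ∀ j, intY (N * k) q t j • u - ((t : K) ^ (2 * G.content j)) • u ∈ wordFil q t e (r - 1) := by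
  induction h with
  | base d R =>
    intro j
    have h1 := piUnit_zpow_mul_intY (N * k) q t d (j - d)
    rw [sub_add_cancel] at h1
    rw [smul_smul, ← h1, mul_smul, hY, smul_algebra_smul_comm, content_shift, sub_self]
    exact zero_mem _
  | @step r G u i hn hi hu ih =>
    intro j
    have hr := hu.pos
    rw [Nat.add_sub_cancel, content_swap]
    have hmem := hu.mem_wordFil
    have hsucc : ∀ i, ∀ w ∈ wordFil q t e (r - 1), intT (N * k) q t i • w ∈ wordFil q t e r := by
      intro i w hw
      have := intT_smul_mem_wordFil ht hq hT (r - 1) i hw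
      rwa [Nat.sub_add_cancel hr] at this
    by_cases h0 : ((N * k : ℕ) : ℤ) ∣ j - i
    · rw [← intT_congr h0, ← perSwap_congr h0, perSwap_self hn]
      -- This is `Y_{j+1} = T_j Y_j T_j` multiplied by `T_j⁻¹ = T_j - (t - t⁻¹)`. The correction
      -- term applies only `Y_{j+1}` to `u`, so it stays among shorter words.
      have key : intY (N * k) q t j * intT (N * k) q t j =
          (intT (N * k) q t j - algebraMap K _ ((t : K) - (t : K)⁻¹)) *
            intY (N * k) q t (j + 1) := by
        have h2 : (intT (N * k) q t j - algebraMap K _ ((t : K) - (t : K)⁻¹)) *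
            intT (N * k) q t j = 1 := by
          rw [sub_mul, ← Algebra.smul_def, intT_mul_intT]
          exact add_sub_cancel_left _ _
        rw [← intT_intY_intT, mul_assoc (intT _ _ _ _) (intY _ _ _ _), ← mul_assoc, h2, one_mul]
      obtain ⟨w, hw, hw'⟩ : ∃ w ∈ wordFil q t e (r - 1), intY (N * k) q t (j + 1) • u =
          ((t : K) ^ (2 * G.content (j + 1))) • u + w := ⟨_, ih (j + 1), by abel⟩
      rw [smul_smul, key, mul_smul, hw', sub_smul, algebraMap_smul, smul_add,
        smul_algebra_smul_comm, add_sub_assoc, add_sub_cancel_left]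
      exact sub_mem (hsucc _ _ hw) (Submodule.smul_mem _ _ (add_mem (Submodule.smul_mem _ _ hmem)
        (wordFil_mono (Nat.sub_le _ _) hw)))
    by_cases h1 : ((N * k : ℕ) : ℤ) ∣ j - (i + 1)
    · obtain ⟨a, rfl⟩ : ∃ a, j = a + 1 := ⟨j - 1, by ring⟩
      have h1' : ((N * k : ℕ) : ℤ) ∣ a - i := by simpa using h1
      rw [← intT_congr h1', ← perSwap_congr h1', perSwap_succ hn]
      have key : intY (N * k) q t (a + 1) * intT (N * k) q t a =
          ((t : K) - (t : K)⁻¹) • intY (N * k) q t (a + 1) +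
            intT (N * k) q t a * intY (N * k) q t a := by
        conv_lhs => rw [← intT_intY_intT, mul_assoc, intT_mul_intT, mul_add, mul_one,
          mul_smul_comm, intT_intY_intT]
      obtain ⟨w, hw, hw'⟩ : ∃ w ∈ wordFil q t e (r - 1), intY (N * k) q t (a + 1) • u =
          ((t : K) ^ (2 * G.content (a + 1))) • u + w := ⟨_, ih (a + 1), by abel⟩
      obtain ⟨x, hx, hx'⟩ : ∃ x ∈ wordFil q t e (r - 1), intY (N * k) q t a • u =
          ((t : K) ^ (2 * G.content a)) • u + x := ⟨_, ih a, by abel⟩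
      rw [smul_smul, key, add_smul, smul_assoc, hw', mul_smul, hx', smul_add (intT _ _ _ _),
        smul_algebra_smul_comm, add_sub_assoc, add_sub_cancel_left]
      exact add_mem (Submodule.smul_mem _ _ (add_mem (Submodule.smul_mem _ _ hmem)
        (wordFil_mono (Nat.sub_le _ _) hw))) (hsucc _ _ hx)
    · rw [smul_smul, ← intT_intY_comm h0 h1, mul_smul, perSwap_of_not_dvd h0 h1,
        ← smul_algebra_smul_comm, ← smul_sub]
      exact hsucc _ _ (ih j)

/-- A triangular operator with nonzero diagonal entries has a triangular inverse, by induction on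
the length. -/
theorem intYInv_smul_mem_wordFil (j : ℤ) (r : ℕ) : ∀ u ∈ wordFil q t e r,
    intYInv (N * k) q t j • u ∈ wordFil q t e r := by
  induction r with
  | zero =>
    refine fun u hu => smul_mem_of_mem_span _ ?_ hu
    rintro u ⟨s, hs, G, hu⟩
    have := hu.pos
    omega
  | succ r ih =>
    refine fun u hu => smul_mem_of_mem_span _ ?_ hu
    rintro u ⟨s, hs, G, hu⟩
    have h1 := hu.intY_smul_sub_mem ht hq hT hY j
    have h2 := ih _ (wordFil_mono (show s - 1 ≤ r by omega) h1)
    have h0 : (t : K) ^ (2 * G.content j) ≠ 0 := zpow_ne_zero _ t.ne_zero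
    rw [smul_sub, smul_smul, intYInv_mul_intY, one_smul, smul_algebra_smul_comm] at h2
    have h3 : intYInv (N * k) q t j • u = ((t : K) ^ (2 * G.content j))⁻¹ • (u -
        (u - ((t : K) ^ (2 * G.content j)) • intYInv (N * k) q t j • u)) := by
      rw [sub_sub_cancel, smul_smul, inv_mul_cancel₀ h0, one_smul]
    rw [h3]
    exact Submodule.smul_mem _ _ (sub_mem (wordFil_mono hs hu.mem_wordFil)
      (wordFil_mono (Nat.le_succ r) h2))

theorem smul_mem_allWords (a : Alg (N * k) q t) :
    ∀ u ∈ allWords q t e, a • u ∈ allWords q t e := by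
  obtain ⟨x, rfl⟩ := RingQuot.mkAlgHom_surjective K (Rel (N * k) q t) a
  induction x using FreeAlgebra.induction with
  | grade0 c =>
    intro u hu
    rw [AlgHom.commutes, algebraMap_smul]
    exact Submodule.smul_mem _ _ hu
  | add x y hx hy =>
    intro u hu
    rw [map_add, add_smul]
    exact add_mem (hx u hu) (hy u hu)
  | mul x y hx hy =>
    intro u hu
    rw [map_mul, mul_smul]
    exact hx _ (hy u hu)
  | grade1 g =>
    refine fun u hu => smul_mem_of_mem_span _ ?_ hu
    rintro u ⟨r, G, hu⟩
    change of (N * k) q t g • u ∈ _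
    have hz : ∀ i : ZMod (N * k), zlabel i / ((N * k : ℕ) : ℤ) = 0 := fun i =>
      Int.ediv_eq_zero_of_lt (zlabel_nonneg i) (zlabel_lt i)
    cases g with
    | T i =>
      have := intT_smul_mem_wordFil ht hq hT r (zlabel i) hu.mem_wordFil
      rw [intT, cast_zlabel] at this
      exact wordFil_le_allWords _ this
    | pi =>
      have := hu.shift 1
      rw [zpow_one] at this
      exact Submodule.subset_span ⟨_, _, this⟩
    | piInv =>
      have := hu.shift (-1)
      rw [zpow_neg_one] at this
      exact Submodule.subset_span ⟨_, _, this⟩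
    | Y i =>
      have := hu.intY_smul_sub_mem ht hq hT hY (zlabel i)
      rw [intY, cast_zlabel, hz, neg_zero, zpow_zero, one_smul] at this
      rw [← sub_add_cancel (of (N * k) q t (Gen.Y i) • u)
        (((t : K) ^ (2 * G.content (zlabel i))) • u)]
      exact add_mem (wordFil_le_allWords _ this)
        (Submodule.smul_mem _ _ (wordFil_le_allWords _ hu.mem_wordFil))
    | YInv i =>
      have := intYInv_smul_mem_wordFil ht hq hT hY (zlabel i) _ _ hu.mem_wordFil
      rw [intYInv, cast_zlabel, hz, zpow_zero, one_smul] at this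
      exact wordFil_le_allWords _ this

end WordFiltration

/-! ### Rectangular tableaux are determined by their contents -/

section Tableaux

open DAHA StripFilling

variable {N k : ℕ}

theorem IsStandardFilling.le_of_le {R : Fin N × Fin k ≃ Fin (N * k)} (hR : IsStandardFilling R)
    {a b : Fin N × Fin k} (h : a ≤ b) : R a ≤ R b :=
  ((hR.1 a.1).monotone h.2 : R (a.1, a.2) ≤ R (a.1, b.2)).trans ((hR.2 b.2).monotone h.1)

theorem IsStandardFilling.lt_of_lt {R : Fin N × Fin k ≃ Fin (N * k)} (hR : IsStandardFilling R)
    {a b : Fin N × Fin k} (h : a < b) : R a < R b :=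
  lt_of_le_of_ne (hR.le_of_le h.le) fun he => h.ne (R.injective he)

/-- Take the first label placed differently. Its two boxes lie on one diagonal, so one precedes the
other strictly; in the tableau that uses the later box, the earlier box has a smaller label, which
both tableaux place alike, a contradiction. -/
theorem RectSYT.eq_of_diag_eq {R S : RectSYT N k} (h : ∀ l, R.diag l = S.diag l) : R = S := by
  have key : ∀ l, R.1.symm l = S.1.symm l := by
    intro l
    induction l using WellFoundedLT.induction with
    | _ l ih =>
    have hl := h l
    unfold RectSYT.diag at hl
    rcases lt_trichotomy (R.1.symm l).1 (S.1.symm l).1 with h1 | h1 | h1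
    · exfalso
      have h1' : ((R.1.symm l).1 : ℕ) < (S.1.symm l).1 := h1
      have h2 : (R.1.symm l).2 < (S.1.symm l).2 := by
        rw [Fin.lt_def]
        omega
      have h3 := S.2.lt_of_lt (Prod.lt_of_lt_of_le h1 h2.le)
      rw [Equiv.apply_symm_apply] at h3
      have h4 := ih _ h3
      rw [Equiv.symm_apply_apply, Equiv.symm_apply_eq, Equiv.apply_symm_apply] at h4
      exact h3.ne h4
    · have h1' : ((R.1.symm l).1 : ℕ) = (S.1.symm l).1 := by rw [h1]
      exact Prod.ext h1 (Fin.ext (by omega))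
    · exfalso
      have h1' : ((S.1.symm l).1 : ℕ) < (R.1.symm l).1 := h1
      have h2 : (S.1.symm l).2 < (R.1.symm l).2 := by
        rw [Fin.lt_def]
        omega
      have h3 := R.2.lt_of_lt (Prod.lt_of_lt_of_le h1 h2.le)
      rw [Equiv.apply_symm_apply] at h3
      have h4 := ih _ h3
      rw [Equiv.symm_apply_apply, eq_comm, Equiv.symm_apply_eq, Equiv.apply_symm_apply] at h4
      exact h3.ne h4
  exact Subtype.ext (by simpa using congrArg Equiv.symm (Equiv.ext key))

/-- The tableau filled row by row. -/
def rowReading (N k : ℕ) : RectSYT N k :=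
  ⟨finProdFinEquiv, fun a b b' h => by
    rw [Fin.lt_def] at h ⊢
    simp only [finProdFinEquiv_apply_val]
    omega, fun b a a' h => by
    have hk : 0 < k := by have := b.2; omega
    rw [Fin.lt_def] at h ⊢
    simp only [finProdFinEquiv_apply_val]
    have := Nat.mul_lt_mul_of_pos_left h hk
    omega⟩

/-- Without descents the permutation is strictly increasing, which bounds its values from below and
from above by the identity. -/
theorem exists_descent {n : ℕ} {σ : Equiv.Perm (Fin n)} (hσ : σ ≠ 1) :
    ∃ (i : ℕ) (hi : i + 1 < n), σ ⟨i + 1, hi⟩ < σ ⟨i, Nat.lt_of_succ_lt hi⟩ := by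
  by_contra! hcon
  have hlt : ∀ (i : ℕ) (hi : i + 1 < n), (σ ⟨i, Nat.lt_of_succ_lt hi⟩ : ℕ) < σ ⟨i + 1, hi⟩ := by
    intro i hi
    refine Fin.lt_def.1 (lt_of_le_of_ne (hcon i hi) fun h => ?_)
    simpa using σ.injective h
  have h1 : ∀ (i : ℕ) (hi : i < n), i ≤ σ ⟨i, hi⟩ := by
    intro i
    induction i with
    | zero => exact fun _ => Nat.zero_le _
    | succ i ih =>
      intro hi
      have := ih (by omega)
      have := hlt i hi
      omega
  have h2 : ∀ (d i : ℕ) (hi : i < n), n - 1 - i = d → (σ ⟨i, hi⟩ : ℕ) ≤ i := by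
    intro d
    induction d with
    | zero =>
      intro i hi hd
      have := (σ ⟨i, hi⟩).2
      omega
    | succ d ih =>
      intro i hi hd
      have := ih (i + 1) (by omega) (by omega)
      have := hlt i (by omega)
      omega
  exact hσ (Equiv.ext fun l => Fin.ext (le_antisymm (h2 _ l l.2 rfl) (h1 l l.2)))

variable [NeZero N] [NeZero k]

/-- The contents of the labels and standardness on rectangles determine the distribution of the
labels to rectangles. -/
theorem StripFilling.IsBlockStandard.block_eq {G : StripFilling N}
    (hG : G.IsBlockStandard (N * k) k) {R : Fin N × Fin k ≃ Fin (N * k)}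
    (h : ∀ j, G.content j = (stripExt R).content j) (i : ℤ) :
    G.block k i = i / ((N * k : ℕ) : ℤ) := by
  have hN := NeZero.pos N
  have hk : (0 : ℤ) < k := by exact_mod_cast NeZero.pos k
  have hn : (0 : ℤ) < (N * k : ℕ) := by exact_mod_cast NeZero.pos (N * k)
  have key : ∀ i, G.block k i = 0 → i / ((N * k : ℕ) : ℤ) = 0 := by
    intro i hi
    -- The corners of the zeroth rectangle have the largest and the smallest label in it. In
    -- `stripExt R` content `k - N` forces a column below `k`, so `a < n`; content `0` forces a
    -- column at least `0`, so `b ≥ 0`. Hence all labels of the rectangle lie in `[0, n)`.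
    obtain ⟨a, ha⟩ := G.surjective (⟨N - 1, by omega⟩, (k : ℤ) - 1)
    obtain ⟨b, hb⟩ := G.surjective (⟨0, by omega⟩, 0)
    have ha1 := h a
    have hb1 := h b
    simp only [content, ha, hb] at ha1 hb1
    have ha2 := (stripExt R a).1.2
    have ha3 : a / ((N * k : ℕ) : ℤ) < 1 := by
      rw [← stripExt_block R, Int.ediv_lt_iff_lt_mul hk]
      omega
    have hb3 : 0 ≤ b / ((N * k : ℕ) : ℤ) := by
      rw [← stripExt_block R]
      exact Int.ediv_nonneg (by omega) hk.le
    rw [Int.ediv_lt_iff_lt_mul hn] at ha3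
    rw [Int.le_ediv_iff_mul_le hn] at hb3
    have hi0 : 0 ≤ (G i).2 / (k : ℤ) := hi.ge
    have hi1 : (G i).2 / (k : ℤ) < 1 := by
      have : (G i).2 / (k : ℤ) = 0 := hi
      omega
    rw [Int.ediv_lt_iff_lt_mul hk] at hi1
    rw [Int.le_ediv_iff_mul_le hk] at hi0
    have hia : i ≤ a := by
      refine hG.2 i a ?_ ?_
      · rw [hi, block, ha, Int.ediv_eq_zero_of_lt] <;> omega
      · rw [ha, Prod.le_def, Fin.le_def]
        have := (G i).1.2
        simp only
        omega
    have hib : b ≤ i := by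
      refine hG.2 b i ?_ ?_
      · rw [hi, block, hb, Int.zero_ediv]
      · rw [hb, Prod.le_def, Fin.le_def]
        simp only
        omega
    exact Int.ediv_eq_zero_of_lt (by omega) (by omega)
  -- Any label is moved into the zeroth rectangle by a multiple of the period.
  have h1 := hG.1.block_add_mul i (-G.block k i)
  rw [add_neg_cancel] at h1
  have h2 := key _ h1
  rw [Int.add_mul_ediv_left _ _ hn.ne'] at h2
  omega

end Tableaux

/-! ### Multiplicity one and the largest proper submodule -/

section Quotient

open DAHA StripFilling

variable {K : Type*} [Field K] {N k : ℕ} [NeZero N] [NeZero k] {q t : Kˣ}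
  {M : Type*} [AddCommGroup M] [Module K M] [Module (Alg (N * k) q t) M]
  {e : RectSpace K N k →ₗ[K] M}

/-- Only one word has the weight of a given rectangular tableau. -/
theorem IsWord.eq_of_content {r : ℕ} {G : StripFilling N} {u : M} (hu : IsWord q t e r G u)
    {R : RectSYT N k} (h : ∀ j, G.content j = (stripExt R.1).content j) :
    u = e (rectBasis K R.1) := by
  have hn : (0 : ℤ) < (N * k : ℕ) := by exact_mod_cast NeZero.pos (N * k)
  have hb := hu.isBlockStandard.block_eq h
  cases hu with
  | base d S =>
    have hd : d = 0 := by
      have h0 := hb 0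
      have h1 := hb d
      rw [block_shift, stripExt_block_eq] at h0 h1
      simp only [sub_self, zero_sub, Int.zero_ediv] at h0 h1
      have h2 : 0 ≤ -d := by
        rw [Int.ediv_eq_iff_of_pos hn] at h0
        linarith [h0.1]
      have h3 : 0 ≤ d := by
        have := h1.symm
        rw [Int.ediv_eq_iff_of_pos hn] at this
        linarith [this.1]
      omega
    subst hd
    rw [shift_zero] at h
    have hS : S = R := RectSYT.eq_of_diag_eq fun l => by
      rw [← stripExt_content, ← stripExt_content, h]
    rw [hS, zpow_zero, Units.val_one, one_smul]
  | @step _ G u i hn2 hi hu =>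
    -- The last letter creates a descent of the rectangle index, while `j / n` increases weakly with
    -- `j`.
    exfalso
    have h0 := hb i
    have h1 := hb (i + 1)
    rw [block_swap, Function.comp_apply, perSwap_self hn2] at h0
    rw [block_swap, Function.comp_apply, perSwap_succ hn2] at h1
    have := Int.ediv_le_ediv hn (show i ≤ i + 1 by omega)
    omega

theorem commute_of_mem_adjoin_intY {n : ℕ} {a b : Alg n q t}
    (ha : a ∈ Algebra.adjoin K (Set.range (intY n q t)))
    (hb : b ∈ Algebra.adjoin K (Set.range (intY n q t))) : Commute a b := by
  refine Algebra.commute_of_mem_adjoin_of_forall_mem_commute hb ?_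
  rintro _ ⟨j, rfl⟩
  refine (Algebra.commute_of_mem_adjoin_of_forall_mem_commute ha ?_).symm
  rintro _ ⟨i, rfl⟩
  exact intY_comm n q t j i

variable [IsScalarTower K (Alg (N * k) q t) M]
  {ρ : affineHecke (N * k) q t →ₐ[K] Module.End K (RectSpace K N k)} (hρ : IsRectangular ρ)
  (he : ∀ (b : affineHecke (N * k) q t) v, (b : Alg (N * k) q t) • e v = e (ρ b v))

section

include hρ he

omit [IsScalarTower K (Alg (N * k) q t) M] [NeZero N] [NeZero k] in
theorem intT_smul_rect {i : ℕ} (hi : i + 1 < N * k) (v : RectSpace K N k) :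
    intT (N * k) q t i • e v =
      e (seminormalT N k t ⟨i, Nat.lt_of_succ_lt hi⟩ ⟨i + 1, hi⟩ v) := by
  rw [← hρ.1 i hi, ← he, affineHecke.T, intT]
  push_cast
  rfl

omit [IsScalarTower K (Alg (N * k) q t) M] [NeZero N] [NeZero k] hρ in
theorem exists_intT_smul_rect (i : ℤ) (hi : ¬ ((N * k : ℕ) : ℤ) ∣ i + 1) (v : RectSpace K N k) :
    ∃ w, intT (N * k) q t i • e v = e w := by
  have h0 : ((i + 1 : ℤ) : ZMod (N * k)) ≠ 0 := fun h =>
    hi ((ZMod.intCast_zmod_eq_zero_iff_dvd _ _).1 h)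
  exact ⟨_, he (affineHecke.T (N * k) q t _ h0) v⟩

variable (ht : ∀ m : ℕ, 0 < m → t ^ m ≠ 1) (hq : q = t ^ (-(2 * (k : ℤ))))
include ht hq

omit [IsScalarTower K (Alg (N * k) q t) M] in
theorem intY_smul_rect (j : ℤ) (R : RectSYT N k) : intY (N * k) q t j • e (rectBasis K R.1) =
    ((t : K) ^ (2 * (stripExt R.1).content j)) • e (rectBasis K R.1) := by
  have hmem : intY (N * k) q t j ∈ affineHecke (N * k) q t :=
    (affineHecke (N * k) q t).smul_mem (affineHecke.Y (N * k) q t _).2 _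
  have h := he ⟨_, hmem⟩ (rectBasis K R.1)
  refine Eq.trans h ?_
  rw [← e.map_smul]
  congr 1
  refine rectEmb_injective K ?_
  rw [hρ.rectEmb_apply ht hq, map_smul, rectEmb_rectBasis]
  exact stripAction_intY ht hq j _

/-- Polynomials in the `Y_j` that map a given vector to the line of `v_R` and do not vanish on
`v_R`. -/
theorem exists_projection (R : RectSYT N k) (r : ℕ) : ∀ u ∈ wordFil q t e r,
    ∃ p ∈ Algebra.adjoin K (Set.range (intY (N * k) q t)), ∃ c : K, c ≠ 0 ∧
      p • e (rectBasis K R.1) = c • e (rectBasis K R.1) ∧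
      ∃ c' : K, p • u = c' • e (rectBasis K R.1) := by
  induction r with
  | zero =>
    intro u hu
    obtain rfl : u = 0 := by
      rw [wordFil, Submodule.span_eq_bot.2] at hu
      · exact hu
      · rintro u ⟨s, hs, G, hu⟩
        have := hu.pos
        omega
    exact ⟨1, one_mem _, 1, one_ne_zero, by simp, 0, by simp⟩
  | succ r ih =>
    intro u hu
    induction hu using Submodule.span_induction with
    | zero => exact ⟨1, one_mem _, 1, one_ne_zero, by simp, 0, by simp⟩
    | add x y _ _ hx hy =>
      obtain ⟨p, hp, c, hc, hpc, c', hpc'⟩ := hx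
      obtain ⟨p', hp', d, hd, hpd, d', hpd'⟩ := hy
      refine ⟨p * p', mul_mem hp hp', c * d, mul_ne_zero hc hd, ?_, d * c' + c * d', ?_⟩
      · rw [mul_smul, hpd, smul_algebra_smul_comm, hpc, smul_smul, mul_comm]
      · rw [smul_add, mul_smul p p' y, hpd', (commute_of_mem_adjoin_intY hp hp').eq, mul_smul,
          hpc', smul_algebra_smul_comm, smul_algebra_smul_comm, hpd, hpc, smul_smul, smul_smul,
          ← add_smul, mul_comm c', mul_comm d']
    | smul a x _ hx =>
      obtain ⟨p, hp, c, hc, hpc, c', hpc'⟩ := hx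
      exact ⟨p, hp, c, hc, hpc, a * c', by rw [smul_algebra_smul_comm, hpc', smul_smul]⟩
    | mem u hu =>
      obtain ⟨s, hs, G, hu⟩ := hu
      by_cases h : ∀ j, G.content j = (stripExt R.1).content j
      · rw [hu.eq_of_content h]
        exact ⟨1, one_mem _, 1, one_ne_zero, by simp, 1, by simp⟩
      · push Not at h
        obtain ⟨j, hj⟩ := h
        have hw := hu.intY_smul_sub_mem ht hq (exists_intT_smul_rect he)
          (intY_smul_rect hρ he ht hq) j
        obtain ⟨p, hp, c, hc, hpc, c', hpc'⟩ := ih _ (wordFil_mono (show s - 1 ≤ r by omega) hw)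
        have h0 : (t : K) ≠ 0 := t.ne_zero
        -- The new factor cancels the leading term of `u` and leaves shorter words, which `p`
        -- handles. On `v_R` it is the difference of two distinct weights, which is nonzero because
        -- `t` is not a root of unity.
        refine ⟨p * (intY (N * k) q t j - algebraMap K _ ((t : K) ^ (2 * G.content j))),
          mul_mem hp (sub_mem (Algebra.subset_adjoin ⟨j, rfl⟩) (Subalgebra.algebraMap_mem _ _)),
          ((t : K) ^ (2 * (stripExt R.1).content j) - (t : K) ^ (2 * G.content j)) * c,
          mul_ne_zero (sub_ne_zero.2 fun h => ?_) hc, ?_, c', ?_⟩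
        · refine zpow_two_mul_ne_one ht (sub_ne_zero.2 hj.symm) ?_
          rw [mul_sub, zpow_sub₀ h0, h, div_self (zpow_ne_zero _ h0)]
        · rw [mul_smul, sub_smul, intY_smul_rect hρ he ht hq, algebraMap_smul, ← sub_smul,
            smul_algebra_smul_comm, hpc, smul_smul]
        · rw [mul_smul, sub_smul, algebraMap_smul, hpc']

end

theorem mem_wordFil_of_span_eq_top
    (hρ : IsRectangular ρ)
    (he : ∀ (b : affineHecke (N * k) q t) v, (b : Alg (N * k) q t) • e v = e (ρ b v))
    (ht : ∀ m : ℕ, 0 < m → t ^ m ≠ 1) (hq : q = t ^ (-(2 * (k : ℤ))))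
    (hgen : Submodule.span (Alg (N * k) q t) (Set.range e) = ⊤) (u : M) :
    ∃ r, u ∈ wordFil q t e r := by
  have hall : u ∈ allWords q t e := by
    have hu : u ∈ Submodule.span (Alg (N * k) q t) (Set.range e) := hgen ▸ Submodule.mem_top
    induction hu using Submodule.span_induction with
    | mem u hu =>
      obtain ⟨v, rfl⟩ := hu
      have h := base_mem_wordSpan (q := q) (t := t) (e := e) 0 v
      rw [zpow_zero, Units.val_one, one_smul] at h
      exact wordFil_le_allWords 1 (wordSpan_le_wordFil le_rfl _ h)
    | zero => exact zero_mem _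
    | add x y _ _ hx hy => exact add_mem hx hy
    | smul a x _ hx =>
      exact smul_mem_allWords ht hq (exists_intT_smul_rect he) (intY_smul_rect hρ he ht hq) a x hx
  induction hall using Submodule.span_induction with
  | mem u hu =>
    obtain ⟨r, G, hu⟩ := hu
    exact ⟨r, hu.mem_wordFil⟩
  | zero => exact ⟨0, zero_mem _⟩
  | add x y _ _ hx hy =>
    obtain ⟨r, hr⟩ := hx
    obtain ⟨s, hs⟩ := hy
    exact ⟨max r s, add_mem (wordFil_mono (le_max_left _ _) hr)
      (wordFil_mono (le_max_right _ _) hs)⟩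
  | smul a x _ hx =>
    obtain ⟨r, hr⟩ := hx
    exact ⟨r, Submodule.smul_mem _ _ hr⟩

include hρ he in
/-- The vector of the row reading tableau generates the rectangular representation. -/
theorem rect_mem_of_rowReading_mem (ht : ∀ m : ℕ, 0 < m → t ^ m ≠ 1)
    (W : Submodule (Alg (N * k) q t) M)
    (hW : e (rectBasis K (rowReading N k).1) ∈ W) (R : RectSYT N k) :
    e (rectBasis K R.1) ∈ W := by
  classical
  by_contra hR
  -- A potential that pairs each label with the row reading number of its box. Exchanging `i` and `i
  -- + 1` at a descent increases it, so a counterexample with maximal `f` has a neighbour whose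
  -- vector lies in `W`.
  let f : RectSYT N k → ℤ := fun R =>
    ∑ l : Fin (N * k), ((l : ℕ) : ℤ) * (((rowReading N k).1 (R.1.symm l) : ℕ) : ℤ)
  have : Nonempty {R : RectSYT N k // e (rectBasis K R.1) ∉ W} := ⟨⟨R, hR⟩⟩
  obtain ⟨⟨R, hR⟩, hmax⟩ := Finite.exists_max
    fun R : {R : RectSYT N k // e (rectBasis K R.1) ∉ W} => f R.1
  have hne : R.1.symm.trans (rowReading N k).1 ≠ 1 := fun h => hR (by
    have : R = rowReading N k := Subtype.ext (Equiv.ext fun x => by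
      have := Equiv.congr_fun h (R.1 x)
      simpa using this.symm)
    rwa [this])
  obtain ⟨i, hi, hlt⟩ := exists_descent hne
  simp only [Equiv.trans_apply] at hlt
  -- One order of the boxes contradicts the descent, since the row reading is standard; the other
  -- contradicts standardness of `R`.
  have hinc : ¬ Comparable (stripExt R.1 (i : ℕ)) (stripExt R.1 ((i : ℕ) + 1)) := by
    have e1 := stripExt_apply_fin R.1 ⟨i, Nat.lt_of_succ_lt hi⟩
    have e2 := stripExt_apply_fin R.1 ⟨i + 1, hi⟩
    simp only [Nat.cast_add, Nat.cast_one] at e1 e2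
    rw [e1, e2]
    rintro (h | h)
    · rw [Prod.mk_le_mk] at h
      have h' : R.1.symm ⟨i, Nat.lt_of_succ_lt hi⟩ ≤ R.1.symm ⟨i + 1, hi⟩ :=
        ⟨h.1, by rw [Fin.le_def]; exact_mod_cast h.2⟩
      exact absurd ((rowReading N k).2.le_of_le h') (not_le.2 hlt)
    · rw [Prod.mk_le_mk] at h
      have h' : R.1.symm ⟨i + 1, hi⟩ ≤ R.1.symm ⟨i, Nat.lt_of_succ_lt hi⟩ :=
        ⟨h.1, by rw [Fin.le_def]; exact_mod_cast h.2⟩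
      have := R.2.le_of_le h'
      rw [Equiv.apply_symm_apply, Equiv.apply_symm_apply, Fin.le_def] at this
      simp only at this
      omega
  have hn : 2 ≤ N * k := by omega
  have hstd : IsStandardFilling
      (R.1.trans (Equiv.swap ⟨i, Nat.lt_of_succ_lt hi⟩ ⟨i + 1, hi⟩)) := by
    refine isStandardFilling_of_stripExt ?_
    rw [stripExt_swap]
    exact (stripExt_isStandard R.2).swap hinc
  let S : RectSYT N k := ⟨_, hstd⟩
  have hS : e (rectBasis K S.1) ∈ W := by
    by_contra hS
    have h := hmax ⟨S, hS⟩
    refine absurd h (not_le.2 (sub_pos.1 ?_))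
    let τ : Equiv.Perm (Fin (N * k)) := Equiv.swap ⟨i, Nat.lt_of_succ_lt hi⟩ ⟨i + 1, hi⟩
    have e1 : f S = ∑ l, ((τ l : ℕ) : ℤ) * (((rowReading N k).1 (R.1.symm l) : ℕ) : ℤ) := by
      refine (Equiv.sum_comp τ _).symm.trans (Finset.sum_congr rfl fun l _ => ?_)
      simp [S, τ]
    have e2 : τ ⟨i, Nat.lt_of_succ_lt hi⟩ = ⟨i + 1, hi⟩ := Equiv.swap_apply_left _ _
    have e3 : τ ⟨i + 1, hi⟩ = ⟨i, Nat.lt_of_succ_lt hi⟩ := Equiv.swap_apply_right _ _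
    change 0 < f S - f R
    rw [e1, ← Finset.sum_sub_distrib, Fintype.sum_eq_add
      (⟨i, Nat.lt_of_succ_lt hi⟩ : Fin (N * k)) (⟨i + 1, hi⟩ : Fin (N * k))]
    · rw [e2, e3]
      rw [Fin.lt_def] at hlt
      generalize (((rowReading N k).1 (R.1.symm ⟨i, Nat.lt_of_succ_lt hi⟩)) : ℕ) = x at hlt ⊢
      generalize (((rowReading N k).1 (R.1.symm ⟨i + 1, hi⟩)) : ℕ) = y at hlt ⊢
      simp only [Nat.cast_add, Nat.cast_one]
      ring_nf
      omega
    · simp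
    · rintro l ⟨h1, h2⟩
      rw [show τ l = l from Equiv.swap_apply_of_ne_of_ne h1 h2, sub_self]
  have hT := W.smul_mem (intT (N * k) q t i) hS
  have hSR : S.1.trans (Equiv.swap ⟨i, Nat.lt_of_succ_lt hi⟩ ⟨i + 1, hi⟩) = R.1 := by
    ext x
    simp [S]
  rw [intT_smul_rect hρ he hi, seminormalT_rectBasis, hSR, map_add, map_smul, map_smul] at hT
  -- Contents of incomparable boxes differ by at least two, so the coefficient of `v_R` in `T_i v_S`
  -- is invertible.
  have hc : (t : K)⁻¹ + seminormalCoeff t S ⟨i, Nat.lt_of_succ_lt hi⟩ ⟨i + 1, hi⟩ ≠ 0 := by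
    have h1 := content_of_not_comparable hinc
    rw [seminormalCoeff_eq, stripExt_swap, swap_apply, swap_apply, perSwap_self hn,
      perSwap_succ hn]
    refine inv_add_contentCoeff_ne_zero ht ?_ ?_ <;>
    · unfold content at h1
      unfold boxContent
      omega
  have h1 := (W.add_mem_iff_right (W.smul_of_tower_mem _ hS)).1 hT
  exact hR ((Submodule.smul_mem_iff (W.restrictScalars K) hc).1 h1)

include hρ he in
/-- A module that is generated by the rectangular representation has a unique simple quotient. -/
theorem existsUnique_isSimpleModule_quotient (ht : ∀ m : ℕ, 0 < m → t ^ m ≠ 1)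
    (hq : q = t ^ (-(2 * (k : ℤ))))
    (hgen : Submodule.span (Alg (N * k) q t) (Set.range e) = ⊤)
    (h0 : e (rectBasis K (rowReading N k).1) ≠ 0) :
    ∃! W : Submodule (Alg (N * k) q t) M, IsSimpleModule (Alg (N * k) q t) (M ⧸ W) := by
  set v₀ := e (rectBasis K (rowReading N k).1) with hv₀
  have htop : ∀ W : Submodule (Alg (N * k) q t) M, v₀ ∈ W → W = ⊤ := by
    intro W hW
    rw [eq_top_iff, ← hgen, Submodule.span_le]
    rintro _ ⟨v, rfl⟩
    have hR := rect_mem_of_rowReading_mem hρ he ht W hW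
    induction v using Finsupp.induction_linear with
    | zero => simp
    | add v w hv hw =>
      rw [map_add]
      exact add_mem hv hw
    | single R c =>
      have h2 : Finsupp.single R c = c • rectBasis K R.1 := by
        rw [rectBasis, dif_pos R.2, Finsupp.smul_single, smul_eq_mul, mul_one]
      rw [h2, map_smul]
      exact W.smul_of_tower_mem _ (hR R)
  -- The vectors none of whose multiples has a component along `v₀`. Quantifying over all `a` makes
  -- this a submodule, and commutativity of the `Y_j` gives closure under addition.
  let W₀ : Submodule (Alg (N * k) q t) M :=
    { carrier := {u | ∀ a : Alg (N * k) q t,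
        ∃ p ∈ Algebra.adjoin K (Set.range (intY (N * k) q t)), ∃ c : K, c ≠ 0 ∧
          p • v₀ = c • v₀ ∧ p • a • u = 0}
      add_mem' := by
        intro x y hx hy a
        obtain ⟨p, hp, c, hc, hpc, hpx⟩ := hx a
        obtain ⟨p', hp', d, hd, hpd, hpy⟩ := hy a
        refine ⟨p * p', mul_mem hp hp', c * d, mul_ne_zero hc hd, ?_, ?_⟩
        · rw [mul_smul, hpd, smul_algebra_smul_comm, hpc, smul_smul, mul_comm]
        · rw [smul_add, smul_add, mul_smul p p' (a • y), hpy,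
            (commute_of_mem_adjoin_intY hp hp').eq, mul_smul, hpx, smul_zero, smul_zero, add_zero]
      zero_mem' := fun a => ⟨1, one_mem _, 1, one_ne_zero, by simp, by simp⟩
      smul_mem' := by
        intro b x hx a
        rw [smul_smul]
        exact hx (a * b) }
  have hlt : W₀ ≠ ⊤ := by
    intro h
    have hv : v₀ ∈ W₀ := h ▸ Submodule.mem_top
    obtain ⟨p, -, c, hc, hpc, hp0⟩ := hv 1
    rw [one_smul, hpc] at hp0
    exact (smul_eq_zero.1 hp0).elim hc h0
  have hle : ∀ W : Submodule (Alg (N * k) q t) M, W ≠ ⊤ → W ≤ W₀ := by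
    intro W hW u hu a
    obtain ⟨r, hr⟩ := mem_wordFil_of_span_eq_top hρ he ht hq hgen (a • u)
    obtain ⟨p, hp, c, hc, hpc, c', hpc'⟩ :=
      exists_projection hρ he ht hq (rowReading N k) r _ hr
    refine ⟨p, hp, c, hc, hpc, ?_⟩
    by_cases h : c' = 0
    · rw [hpc', h, zero_smul]
    · have h1 := W.smul_mem p (W.smul_mem a hu)
      rw [hpc'] at h1
      -- A nonzero component along `v₀` would put `v₀`, and with it everything, into `W`.
      exact (hW (htop W ((Submodule.smul_mem_iff (W.restrictScalars K) h).1 h1))).elim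
  refine ⟨W₀, isSimpleModule_iff_isCoatom.2 ⟨hlt, fun W hW => ?_⟩, fun W hW => ?_⟩
  · by_contra h
    exact absurd (hle W h) (not_le_of_gt hW)
  · have hW' := isSimpleModule_iff_isCoatom.1 hW
    rcases (hle W hW'.1).lt_or_eq with h | h
    · exact (hlt (hW'.2 _ h)).elim
    · exact h

end Quotient

/-! ### The induced module -/

section InducedModule

variable {K A V : Type*} [Field K] [Ring A] [Algebra K A] [AddCommGroup V] [Module K V]
  {B : Subalgebra K A} (ρ : B →ₐ[K] Module.End K V)

/-- The map from a representation of a subalgebra to the induced module. -/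
noncomputable def inducedMk : V →ₗ[K] Induced ρ :=
  ((inducedRel ρ).mkQ.restrictScalars K) ∘ₗ TensorProduct.mk K A V 1

theorem inducedMk_apply (v : V) :
    inducedMk ρ v = (inducedRel ρ).mkQ ((1 : A) ⊗ₜ[K] v) := rfl

theorem smul_inducedMk (b : B) (v : V) : (b : A) • inducedMk ρ v = inducedMk ρ (ρ b v) := by
  rw [inducedMk_apply, inducedMk_apply, ← map_smul, ← sub_eq_zero, ← map_sub,
    TensorProduct.smul_tmul', smul_eq_mul, mul_one, Submodule.mkQ_apply,
    Submodule.Quotient.mk_eq_zero]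
  exact Submodule.subset_span ⟨b, v, rfl⟩

theorem span_range_inducedMk : Submodule.span A (Set.range (inducedMk ρ)) = ⊤ := by
  rw [eq_top_iff]
  rintro x -
  obtain ⟨x, rfl⟩ := (inducedRel ρ).mkQ_surjective x
  induction x using TensorProduct.induction_on with
  | zero => simp
  | add x y hx hy =>
    rw [map_add]
    exact add_mem hx hy
  | tmul a v =>
    have h : a ⊗ₜ[K] v = a • ((1 : A) ⊗ₜ[K] v) := by
      rw [TensorProduct.smul_tmul', smul_eq_mul, mul_one]
    rw [h, map_smul]
    exact Submodule.smul_mem _ _ (Submodule.subset_span ⟨v, rfl⟩)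

/-- An equivariant map to a representation of the whole algebra factors through the induced
module. -/
theorem eq_zero_of_inducedMk_eq_zero {L : Type*} [AddCommGroup L] [Module K L]
    (act : A →ₐ[K] Module.End K L) (f : V →ₗ[K] L) (hf : ∀ (b : B) v, f (ρ b v) = act b (f v))
    {v : V} (hv : inducedMk ρ v = 0) : f v = 0 := by
  let φ : A ⊗[K] V →ₗ[K] L :=
    TensorProduct.lift ((LinearMap.lcomp K L f) ∘ₗ act.toLinearMap)
  have hφ : ∀ a v, φ (a ⊗ₜ v) = act a (f v) := fun a v => rfl
  have hφs : ∀ (a : A) x, φ (a • x) = act a (φ x) := by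
    intro a x
    induction x using TensorProduct.induction_on with
    | zero => simp
    | add x y hx hy => rw [smul_add, map_add, hx, hy, map_add, map_add]
    | tmul b v => rw [TensorProduct.smul_tmul', hφ, hφ, smul_eq_mul, map_mul, Module.End.mul_apply]
  have hker : ∀ x ∈ inducedRel ρ, φ x = 0 := by
    intro x hx
    induction hx using Submodule.span_induction with
    | mem x hx =>
      obtain ⟨b, v, rfl⟩ := hx
      rw [map_sub, hφ, hφ, map_one, Module.End.one_apply, hf, sub_self]
    | zero => exact map_zero _
    | add x y _ _ hx hy => rw [map_add, hx, hy, add_zero]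
    | smul a x _ hx => rw [hφs, hx, map_zero]
  rw [inducedMk_apply, Submodule.mkQ_apply, Submodule.Quotient.mk_eq_zero] at hv
  have := hker _ hv
  rwa [hφ, map_one, Module.End.one_apply] at this

end InducedModule

theorem theorem6p2 {K : Type*} [Field K] [CharZero K] (N k : ℕ) (hN : 0 < N) (hk : 0 < k)
    (q t : Kˣ) (ht : ∀ m : ℕ, 0 < m → t ^ m ≠ 1) (hq : q = t ^ (-(2 * (k : ℤ)))) :
    (∃! ρ : DAHA.affineHecke (N * k) q t →ₐ[K] Module.End K (RectSpace K N k),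
      IsRectangular ρ) ∧
    ∀ ρ : DAHA.affineHecke (N * k) q t →ₐ[K] Module.End K (RectSpace K N k),
      IsRectangular ρ →
        ∃! W : Submodule (DAHA.Alg (N * k) q t) (Induced ρ),
          IsSimpleModule (DAHA.Alg (N * k) q t) (Induced ρ ⧸ W) := by
  have : NeZero N := ⟨hN.ne'⟩
  have : NeZero k := ⟨hk.ne'⟩
  constructor
  · obtain ⟨ρ, hρ, -⟩ := exists_isRectangular (N := N) ht hq
    exact ⟨ρ, hρ, fun ρ' h => h.unique hρ⟩
  · intro ρ hρ
    refine existsUnique_isSimpleModule_quotient hρ (smul_inducedMk ρ) ht hq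
      (span_range_inducedMk ρ) fun h => ?_
    -- The generating vector survives in the induced module because its image in the strip is a
    -- basis vector.
    have h1 := eq_zero_of_inducedMk_eq_zero ρ (stripAction N k ht hq) (rectEmb K N k)
      (hρ.rectEmb_apply ht hq) h
    have h2 : rectBasis K (rowReading N k).1 = 0 :=
      rectEmb_injective K (h1.trans (map_zero _).symm)
    rw [rectBasis, dif_pos (rowReading N k).2, Finsupp.single_eq_zero] at h2
    exact one_ne_zero h2
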